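/- **Setting.** For a matrix $A$ let $\|A\|_{1,2}$ be the largest Euclidean norm of a column, and call $A$ column-orthogonal if $A^\top A=I$. Let $1\le k\le n$, let $D^*\in\mathbb R^{d\times n}$ (columns $d_i^*$) be column-orthogonal and full-rank (of rank $d$, hence $d=n$), and let $0<\gamma\le\Gamma$, $\sigma>0$. Inputs are generated as $x=D^*\beta$, where the support of $\beta\in\mathbb R^n$ is uniform among the $k$-element subsets of $[n]$ and, given the support, the non-zero entries of $\beta$ are i.i.d. with mean $0$, variance $\sigma^2$ and absolute value in $[\gamma,\Gamma]$. The target is $y=\langle x,z\rangle$ and the answer to query $i$ is $\langle d_i^*,z\rangle$, with $z\sim\mathcal N(0,I_d)$. For $D\in\mathbb R^{d\times n}$ with columns $d_i$ the surrogate estimator is $\tilde f_D=\sum_{i\in S}\langle d_i,x\rangle\langle d_i^*,z\rangle$ with $S\in\arg\max_{T\subseteq[n],|T|\le k}\sum_{i\in T}|\langle d_i,x\rangle|$ (ties broken by any fixed rule). For inputs $x^1,\dots,x^m$ the aggregated loss is $$\mathcal L_m(D)=\frac1m\sum_{h=1}^m\mathbb E_{z\sim\mathcal N(0,I_d)}\Big[\big(\langle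 x^h,z\rangle-\tilde f_D(x^h,z)\big)^2\Big].$$ Constrained concept refinement (CCR) from $D$ with radius $\rho$ and step size $\eta$ sets $\Delta^{(0)}=0$ and $$\Delta^{(t+1)}=\arg\min_{\|E\|_{1,2}\le\rho}\Big\|E-\big(\Delta^{(t)}-\eta\,\nabla_{\Delta}\mathcal L_m(D+\Delta)\big|_{\Delta=\Delta^{(t)}}\big)\Big\|_F,\qquad D^{(t)}=D+\Delta^{(t)}.$$ **Theorem.** There are a constant $c>0$ and a function $\delta:\mathbb N\to\mathbb R$ with $\delta(n)=n^{-\omega(1)}$ (that is, $n^A\delta(n)\to0$ for every $A$), and for all $\kappa,\sigma_0>0$ there is a constant $C>0$ depending only on $\kappa$ and $\sigma_0$, such that the following holds. In the setting above, suppose that $\sigma\le\sigma_0$ and $\Gamma\le\kappa\sigma$, that $x^1,\dots,x^m$ are i.i.d. inputs from the model with $$m\ \ge\ C\,\frac{n^6}{\sigma^2k^5},$$ that the initial matrix $D$ satisfies $\|D-D^*\|_{1,2}=\rho\le\frac{\gamma}{8\sqrt k\,\Gamma}$, and that $0<\eta\le c/\sigma^2$. Then with probability at least $1-\delta(n)$,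 the iterates of CCR applied to $\mathcal L_m$ satisfy, simultaneously for all $t\ge0$: $\mathcal L_m$ is differentiable at $D^{(t)}$, and * (Interpretability) $\|D^{(t+1)}-D^*\|_{1,2}\le\tau\,\|D^{(t)}-D^*\|_{1,2}$, where $\tau=\sqrt{1-\frac{k(k-1)\sigma^2}{2n^2}\eta}$; * (Accuracy) $\mathcal L_m(D^{(t)})\le\frac{k\sum_{h=1}^m\|x^h\|_2^2}{m}\,\|D^{(t)}-D^*\|_{1,2}^2$. -/

import Mathlib

open MeasureTheory ProbabilityTheory Filter
open scoped BigOperators InnerProductSpace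

/-- Real `d × n` matrices, given by their `n` columns in `ℝ^d`. The norm of this space is the
Frobenius norm, its inner product the entrywise one, so `gradient` is the matrix of partial
derivatives. -/
abbrev QueryMatrix (d n : ℕ) : Type := PiLp 2 (fun _ : Fin n => EuclideanSpace ℝ (Fin d))

/-- `‖A‖_{1,2}`: the largest Euclidean norm of a column. -/
noncomputable def maxColNorm {d n : ℕ} (A : QueryMatrix d n) : ℝ :=
  ⨆ i : Fin n, ‖A i‖

/-- `Aᵀ A = I`: the columns are orthonormal. -/
def ColumnOrthogonal {d n : ℕ} (A : QueryMatrix d n) : Prop :=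
  Orthonormal ℝ (fun i : Fin n => A i)

/-- Full-rank: the matrix has rank `d`, i.e. its columns span `ℝ^d`. -/
def FullRank {d n : ℕ} (A : QueryMatrix d n) : Prop :=
  Submodule.span ℝ (Set.range (fun i : Fin n => A i)) = ⊤

/-- The matrix-vector product `A b`. -/
noncomputable def QueryMatrix.mulVec {d n : ℕ} (A : QueryMatrix d n) (b : Fin n → ℝ) :
    EuclideanSpace ℝ (Fin d) :=
  ∑ i, b i • A i

/-- Assumptions on the common law `ν` of the non-zero entries of the sparse code: mean `0`,
variance `σ²`, absolute values in `[γ, Γ]`. -/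
structure IsEntryLaw (ν : Measure ℝ) (γ Γ σ : ℝ) : Prop where
  isProbabilityMeasure : IsProbabilityMeasure ν
  gamma_pos : 0 < γ
  sigma_pos : 0 < σ
  mean_eq : ∫ b, b ∂ν = 0
  variance_eq : Var[fun b => b; ν] = σ ^ 2
  abs_bounds : ∀ᵐ b ∂ν, γ ≤ |b| ∧ |b| ≤ Γ

/-- Law of the random `k`-sparse code `β ∈ ℝ^n`: the support `S` is uniform among the `k`-element
subsets of the index set, and given `S` the entries in `S` are i.i.d. with law `ν`; the other
entries vanish. -/
noncomputable def codeLaw (n k : ℕ) (ν : Measure ℝ) : Measure (Fin n → ℝ) :=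
  ((n.choose k : ENNReal)⁻¹) • ∑ S ∈ Finset.powersetCard k (Finset.univ : Finset (Fin n)),
    (Measure.pi (fun _ : Fin n => ν)).map (fun ξ i => if i ∈ S then ξ i else 0)

/-- `S` is a maximizer of `∑_{i ∈ T} |⟨d_i, x⟩|` over all `T` with at most `k` elements. -/
def IsTopSet {d n : ℕ} (k : ℕ) (D : QueryMatrix d n) (x : EuclideanSpace ℝ (Fin d))
    (S : Finset (Fin n)) : Prop :=
  S.card ≤ k ∧ ∀ T : Finset (Fin n), T.card ≤ k →
    ∑ i ∈ T, |⟪D i, x⟫_ℝ| ≤ ∑ i ∈ S, |⟪D i, x⟫_ℝ|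

/-- A rule choosing the set `S` of the surrogate estimator (it matters only how ties are broken). -/
def IsSelectionRule {d n : ℕ} (k : ℕ)
    (sel : QueryMatrix d n → EuclideanSpace ℝ (Fin d) → Finset (Fin n)) : Prop :=
  ∀ D x, IsTopSet k D x (sel D x)

/-- The surrogate estimator `∑_{i ∈ S} ⟨d_i, x⟩ r_i`, where `r` are the answers to the queries. -/
noncomputable def surrogate {d n : ℕ}
    (sel : QueryMatrix d n → EuclideanSpace ℝ (Fin d) → Finset (Fin n))
    (D : QueryMatrix d n) (x : EuclideanSpace ℝ (Fin d)) (r : Fin n → ℝ) : ℝ :=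
  ∑ i ∈ sel D x, ⟪D i, x⟫_ℝ * r i

/-- The aggregated squared loss of the surrogate estimator on the inputs `x¹, …, xᵐ`:
the target is `⟨x, z⟩`, the answer to query `i` is `⟨d*_i, z⟩`, with `z` standard normal. -/
noncomputable def aggLoss {d n m : ℕ} (Dstar : QueryMatrix d n)
    (sel : QueryMatrix d n → EuclideanSpace ℝ (Fin d) → Finset (Fin n))
    (x : Fin m → EuclideanSpace ℝ (Fin d)) (D : QueryMatrix d n) : ℝ :=
  (1 / (m : ℝ)) * ∑ h, ∫ z, (⟪x h, z⟫_ℝ - surrogate sel D (x h) (fun i => ⟪Dstar i, z⟫_ℝ)) ^ 2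
    ∂(stdGaussian (EuclideanSpace ℝ (Fin d)))

/-- `Δ 0, Δ 1, …` is a run of constrained concept refinement for the loss `L` from the initial
matrix `D`, with correction radius `ρ` and step size `η`: it starts at `0`, and each step is a
gradient step in the correction followed by a nearest-point projection onto the constraint set
`{E | ‖E‖_{1,2} ≤ ρ}`. -/
def IsCCRRun {d n : ℕ} (L : QueryMatrix d n → ℝ) (D : QueryMatrix d n) (ρ η : ℝ)
    (Δ : ℕ → QueryMatrix d n) : Prop :=
  Δ 0 = 0 ∧ ∀ t, maxColNorm (Δ (t + 1)) ≤ ρ ∧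
    IsMinOn (fun E => ‖E - (Δ t - η • gradient (fun F => L (D + F)) (Δ t))‖)
      {E | maxColNorm E ≤ ρ} (Δ (t + 1))

/-!
Write `eᵢ = dᵢ - dᵢ*`. While every column of `D` is within `2ρ ≤ γ / (4 √k Γ)` of that of `D*`,
the numbers `⟨dᵢ, x⟩` differ from the code entries `βᵢ = ⟨dᵢ*, x⟩` by less than `γ / 2`, so the
estimator selects exactly the support of `β` (`IsWellConditioned.sel_eq`). Averaging over the Gaussian
`z` turns the loss into the quadratic function `(1/m) ∑ₕ ∑_{i ∈ supp βʰ} ⟨eᵢ, xʰ⟩²`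
(`IsWellConditioned.aggLoss_eq`). It decouples over the columns: on column `i` it is the form of
`Mᵢ = (1/m) ∑_{h : i ∈ supp βʰ} xʰ (xʰ)ᵀ`. If `Mᵢ ≤ 16 σ²` and
`Mᵢ ≥ k (k - 1) σ² / (4 n²)`, a gradient step with `η ≤ 1 / (32 σ²)` contracts `eᵢ` by the factor `τ`
(`norm_sub_gradient_sq_le`), and the projection onto the constraint set, which contains
`D* - D`, does not increase the distance to `D* - D` in any column (`norm_col_sub_le_of_isMinOn`). The
iterates never leave the region, because the constraint keeps them within `2ρ` of `D*`.

It remains to bound the empirical matrices (`measure_not_isWellConditioned_le`). Since `m` may be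
only of order `n` when `k` is of order `n`, the union bound has to run over nets of the
sphere with exponentially many points, and each point needs a failure probability `exp (-C n)`.
For a fixed unit vector `u` and a fixed support, `⟨u, β⟩` is sub-Gaussian with parameter `Γ²`; this
gives `E exp (⟨u, β⟩² / (4 Γ²)) ≤ 2` (`lintegral_exp_sq_le_two`), hence second-order expansions of the
exponential moments `E exp (± s ⟨u, β⟩²)`. At the scale `s = σ² / (256 Γ⁴)` the linear term
dominates, and Chernoff bounds follow in both directions. The expected form is at least
`σ² k (k - 1) / n²` by counting the `k`-subsets that contain two given indices
(`le_card_filter_mem_mem`). The lower bound needs a net of radius `k / (16 n)`, with at most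
`exp (32 n² / k)` points; the failure probability at each is at most `exp (-34 n² / k)` by the
hypothesis on `m`.
-/

/-! ### Exponential moments of squares of sub-Gaussian variables -/

/-- Writing `exp (X² / (4v))` as the Gaussian average of `exp (t X)` over `t ∼ N(0, 1/(2v))` and
exchanging the two expectations reduces this to a one-dimensional Gaussian integral, equal
to `√2`. -/
lemma lintegral_exp_sq_le_two {Ω : Type*} {mΩ : MeasurableSpace Ω} {μ : Measure Ω}
    [IsProbabilityMeasure μ] {X : Ω → ℝ} {c : NNReal} (hX : HasSubgaussianMGF X c μ)
    (hm : Measurable X) {v : ℝ} (hv : 0 < v) (hcv : (c : ℝ) ≤ v) :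
    ∫⁻ ω, ENNReal.ofReal (Real.exp (X ω ^ 2 / (4 * v))) ∂μ ≤ 2 := by
  obtain ⟨w, hw⟩ : ∃ w : NNReal, (w : ℝ) = 1 / (2 * v) := ⟨⟨1 / (2 * v), by positivity⟩, rfl⟩
  have hw0 : w ≠ 0 := by
    rw [← NNReal.coe_ne_zero, hw]
    positivity
  have key : ∀ x : ℝ, ENNReal.ofReal (Real.exp (x ^ 2 / (4 * v))) =
      ∫⁻ t, ENNReal.ofReal (Real.exp (t * x)) ∂(gaussianReal 0 w) := by
    intro x
    have h1 := mgf_id_gaussianReal (μ := 0) (v := w)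
    have h2 : ∫ t, Real.exp (x * t) ∂(gaussianReal 0 w) = Real.exp (x ^ 2 / (4 * v)) := by
      have := congrFun h1 x
      simp only [mgf, id] at this
      rw [this, hw]
      congr 1
      field_simp
      ring
    rw [← h2, ofReal_integral_eq_lintegral_ofReal]
    · simp_rw [mul_comm x]
    · exact integrable_exp_mul_gaussianReal x
    · exact ae_of_all _ fun t => (Real.exp_pos _).le
  simp_rw [key]
  rw [lintegral_lintegral_swap (by fun_prop)]
  have h3 : ∀ t : ℝ, ∫⁻ ω, ENNReal.ofReal (Real.exp (t * X ω)) ∂μ ≤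
      ENNReal.ofReal (Real.exp (v * t ^ 2 / 2)) := by
    intro t
    rw [← ofReal_integral_eq_lintegral_ofReal (hX.integrable_exp_mul t)
      (ae_of_all _ fun t => (Real.exp_pos _).le)]
    apply ENNReal.ofReal_le_ofReal
    refine (hX.mgf_le t).trans (Real.exp_le_exp.2 ?_)
    gcongr
  refine (lintegral_mono h3).trans ?_
  rw [gaussianReal_of_var_ne_zero _ hw0,
    lintegral_withDensity_eq_lintegral_mul _ (measurable_gaussianPDF 0 w) (by fun_prop)]
  have h4 : ∀ t : ℝ, (gaussianPDF 0 w * fun t => ENNReal.ofReal (Real.exp (v * t ^ 2 / 2))) t =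
      ENNReal.ofReal ((Real.sqrt (Real.pi / v))⁻¹ * Real.exp (-(v / 2) * t ^ 2)) := by
    intro t
    rw [Pi.mul_apply, gaussianPDF, ← ENNReal.ofReal_mul (gaussianPDFReal_nonneg _ _ _),
      gaussianPDFReal, mul_assoc, ← Real.exp_add]
    congr 3
    · congr 1
      rw [hw]
      field_simp
    · rw [hw]
      field_simp
      ring
  simp_rw [h4]
  rw [← ofReal_integral_eq_lintegral_ofReal
    ((integrable_exp_neg_mul_sq (by positivity : 0 < v / 2)).const_mul _)
    (ae_of_all _ fun t => by positivity), integral_const_mul, integral_gaussian,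
    ← Real.sqrt_inv, ← Real.sqrt_mul (by positivity)]
  have h5 : (Real.pi / v)⁻¹ * (Real.pi / (v / 2)) = 2 := by
    have := Real.pi_pos
    field_simp
  rw [h5]
  have h6 : Real.sqrt 2 ≤ 2 := by
    rw [Real.sqrt_le_left (by norm_num)]; norm_num
  calc ENNReal.ofReal (Real.sqrt 2) ≤ ENNReal.ofReal 2 := ENNReal.ofReal_le_ofReal h6
    _ = 2 := by norm_num

lemma integrable_exp_sq {Ω : Type*} {mΩ : MeasurableSpace Ω} {μ : Measure Ω}
    [IsProbabilityMeasure μ] {X : Ω → ℝ} {c : NNReal} (hX : HasSubgaussianMGF X c μ)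
    (hm : Measurable X) {v : ℝ} (hv : 0 < v) (hcv : (c : ℝ) ≤ v) :
    Integrable (fun ω => Real.exp (X ω ^ 2 / (4 * v))) μ := by
  refine ⟨by fun_prop, ?_⟩
  rw [hasFiniteIntegral_iff_ofReal (ae_of_all _ fun t => (Real.exp_pos _).le)]
  exact (lintegral_exp_sq_le_two hX hm hv hcv).trans_lt (by simp)

lemma integral_exp_sq_le_two {Ω : Type*} {mΩ : MeasurableSpace Ω} {μ : Measure Ω}
    [IsProbabilityMeasure μ] {X : Ω → ℝ} {c : NNReal} (hX : HasSubgaussianMGF X c μ)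
    (hm : Measurable X) {v : ℝ} (hv : 0 < v) (hcv : (c : ℝ) ≤ v) :
    ∫ ω, Real.exp (X ω ^ 2 / (4 * v)) ∂μ ≤ 2 := by
  rw [integral_eq_lintegral_of_nonneg_ae (ae_of_all _ fun t => (Real.exp_pos _).le) (by fun_prop)]
  exact ENNReal.toReal_le_of_le_ofReal (by norm_num)
    (by simpa using lintegral_exp_sq_le_two hX hm hv hcv)

lemma sq_le_two_mul_exp {y : ℝ} (hy : 0 ≤ y) : y ^ 2 ≤ 2 * Real.exp y := by
  have := Real.quadratic_le_exp_of_nonneg hy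
  nlinarith

/-- The fourth moment of a sub-Gaussian variable enters through the quadratic term of
`exp (-y) ≤ 1 - y + y² / 2`. -/
lemma lintegral_exp_neg_mul_sq_le {Ω : Type*} {mΩ : MeasurableSpace Ω} {μ : Measure Ω}
    [IsProbabilityMeasure μ] {X : Ω → ℝ} {c : NNReal} (hX : HasSubgaussianMGF X c μ)
    (hm : Measurable X) {v : ℝ} (hv : 0 < v) (hcv : (c : ℝ) ≤ v) {s : ℝ} (hs : 0 ≤ s) :
    ∫⁻ ω, ENNReal.ofReal (Real.exp (-(s * X ω ^ 2))) ∂μ ≤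
      ENNReal.ofReal (1 - s * ∫ ω, X ω ^ 2 ∂μ + 32 * s ^ 2 * v ^ 2) := by
  have hX2 : Integrable (fun ω => X ω ^ 2) μ := (hX.memLp 2).integrable_sq
  have hE := integrable_exp_sq hX hm hv hcv
  have hpt : ∀ ω, Real.exp (-(s * X ω ^ 2)) ≤
      1 - s * X ω ^ 2 + 16 * s ^ 2 * v ^ 2 * Real.exp (X ω ^ 2 / (4 * v)) := by
    intro ω
    set y := s * X ω ^ 2 with hy
    have hy0 : 0 ≤ y := by positivity
    have h1 : Real.exp (-y) ≤ 1 - y + y ^ 2 / 2 := by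
      have h2 := Real.quadratic_le_exp_of_nonneg hy0
      rw [Real.exp_neg, inv_le_iff_one_le_mul₀ (Real.exp_pos _)]
      have h3 : 0 ≤ 1 - y + y ^ 2 / 2 := by nlinarith [sq_nonneg (y - 1)]
      nlinarith [mul_le_mul_of_nonneg_left h2 h3, sq_nonneg (y ^ 2)]
    have h4 := sq_le_two_mul_exp (y := X ω ^ 2 / (4 * v)) (by positivity)
    have h5 : y ^ 2 = 16 * s ^ 2 * v ^ 2 * (X ω ^ 2 / (4 * v)) ^ 2 := by
      rw [hy]; field_simp; ring
    have h6 : 0 ≤ 16 * s ^ 2 * v ^ 2 := by positivity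
    nlinarith [mul_le_mul_of_nonneg_left h4 h6]
  have hint : Integrable (fun ω => Real.exp (-(s * X ω ^ 2))) μ := by
    refine Integrable.of_bound (C := 1) (by fun_prop) (ae_of_all _ fun ω => ?_)
    rw [Real.norm_eq_abs, Real.abs_exp, Real.exp_le_one_iff]
    have : 0 ≤ s * X ω ^ 2 := by positivity
    linarith
  rw [← ofReal_integral_eq_lintegral_ofReal hint (ae_of_all _ fun t => (Real.exp_pos _).le)]
  apply ENNReal.ofReal_le_ofReal
  refine (integral_mono hint
    (((integrable_const 1).sub (hX2.const_mul s)).add (hE.const_mul _)) hpt).trans ?_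
  rw [integral_add' ((integrable_const 1).sub (hX2.const_mul s)) (hE.const_mul _),
    integral_sub' (integrable_const 1) (hX2.const_mul s), integral_const_mul, integral_const_mul]
  have := integral_exp_sq_le_two hX hm hv hcv
  have h6 : 0 ≤ 16 * s ^ 2 * v ^ 2 := by positivity
  simp only [integral_const, probReal_univ, one_smul]
  nlinarith [mul_le_mul_of_nonneg_left this h6]

lemma lintegral_exp_mul_sq_le {Ω : Type*} {mΩ : MeasurableSpace Ω} {μ : Measure Ω}
    [IsProbabilityMeasure μ] {X : Ω → ℝ} {c : NNReal} (hX : HasSubgaussianMGF X c μ)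
    (hm : Measurable X) {v : ℝ} (hv : 0 < v) (hcv : (c : ℝ) ≤ v) {s : ℝ} (hs : 0 ≤ s)
    (hsv : s ≤ 1 / (8 * v)) :
    ∫⁻ ω, ENNReal.ofReal (Real.exp (s * X ω ^ 2)) ∂μ ≤
      ENNReal.ofReal (1 + s * ∫ ω, X ω ^ 2 ∂μ + 256 * s ^ 2 * v ^ 2) := by
  have hX2 : Integrable (fun ω => X ω ^ 2) μ := (hX.memLp 2).integrable_sq
  have hE := integrable_exp_sq hX hm hv hcv
  have hle : ∀ ω, s * X ω ^ 2 ≤ X ω ^ 2 / (8 * v) := by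
    intro ω
    calc s * X ω ^ 2 ≤ 1 / (8 * v) * X ω ^ 2 := by gcongr
      _ = _ := by ring
  have hpt : ∀ ω, Real.exp (s * X ω ^ 2) ≤
      1 + s * X ω ^ 2 + 128 * s ^ 2 * v ^ 2 * Real.exp (X ω ^ 2 / (4 * v)) := by
    intro ω
    set y := s * X ω ^ 2 with hy
    have hy0 : 0 ≤ y := by positivity
    have h1 : Real.exp y ≤ 1 + y + y ^ 2 * Real.exp y := by
      have h2 := Real.add_one_le_exp (-y)
      have h3 : Real.exp (-y) * Real.exp y = 1 := by rw [← Real.exp_add]; simp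
      have h4 : (1 + y) * (1 - y) * Real.exp y ≤ (1 + y) := by
        calc (1 + y) * (1 - y) * Real.exp y ≤ (1 + y) * Real.exp (-y) * Real.exp y := by
              gcongr; linarith
          _ = 1 + y := by rw [mul_assoc, h3, mul_one]
      nlinarith
    set w := X ω ^ 2 / (8 * v) with hw
    have hw0 : 0 ≤ w := by positivity
    have h5 : y ^ 2 = 64 * s ^ 2 * v ^ 2 * w ^ 2 := by
      rw [hy, hw]; field_simp; ring
    have h6 : Real.exp (X ω ^ 2 / (4 * v)) = Real.exp w * Real.exp w := by
      rw [← Real.exp_add]; congr 1; rw [hw]; field_simp; ring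
    have h7 : y ^ 2 * Real.exp y ≤
        128 * s ^ 2 * v ^ 2 * Real.exp (X ω ^ 2 / (4 * v)) := by
      calc y ^ 2 * Real.exp y ≤ 64 * s ^ 2 * v ^ 2 * (2 * Real.exp w) * Real.exp w := by
            rw [h5]
            gcongr
            · exact sq_le_two_mul_exp hw0
            · exact hle ω
        _ = _ := by rw [h6]; ring
    linarith
  have hint : Integrable (fun ω => Real.exp (s * X ω ^ 2)) μ := by
    refine hE.mono' (by fun_prop) (ae_of_all _ fun ω => ?_)
    rw [Real.norm_eq_abs, Real.abs_exp, Real.exp_le_exp]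
    refine (hle ω).trans ?_
    gcongr
    norm_num
  rw [← ofReal_integral_eq_lintegral_ofReal hint (ae_of_all _ fun t => (Real.exp_pos _).le)]
  apply ENNReal.ofReal_le_ofReal
  refine (integral_mono hint
    (((integrable_const 1).add (hX2.const_mul s)).add (hE.const_mul _)) hpt).trans ?_
  rw [integral_add' ((integrable_const 1).add (hX2.const_mul s)) (hE.const_mul _),
    integral_add' (integrable_const 1) (hX2.const_mul s), integral_const_mul, integral_const_mul]
  have := integral_exp_sq_le_two hX hm hv hcv
  have h6 : 0 ≤ 128 * s ^ 2 * v ^ 2 := by positivity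
  simp only [integral_const, probReal_univ, one_smul]
  nlinarith [mul_le_mul_of_nonneg_left this h6]

/-! ### Linear forms in independent entries -/

section LinearForm

variable {ν : Measure ℝ} {γ Γ σ : ℝ}

lemma IsEntryLaw.integral_sq (hν : IsEntryLaw ν γ Γ σ) : ∫ b, b ^ 2 ∂ν = σ ^ 2 := by
  have := hν.isProbabilityMeasure
  rw [← hν.variance_eq]
  exact (variance_of_integral_eq_zero aemeasurable_id hν.mean_eq).symm

lemma IsEntryLaw.gamma_le (hν : IsEntryLaw ν γ Γ σ) : γ ≤ Γ := by
  have := hν.isProbabilityMeasure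
  obtain ⟨b, hb⟩ := hν.abs_bounds.exists
  exact hb.1.trans hb.2

lemma IsEntryLaw.Gamma_pos (hν : IsEntryLaw ν γ Γ σ) : 0 < Γ :=
  hν.gamma_pos.trans_le hν.gamma_le

lemma IsEntryLaw.sigma_le (hν : IsEntryLaw ν γ Γ σ) : σ ≤ Γ := by
  have := hν.isProbabilityMeasure
  have h : ∫ b, b ^ 2 ∂ν ≤ ∫ _, Γ ^ 2 ∂ν := by
    apply integral_mono_of_nonneg (ae_of_all _ fun b => sq_nonneg b) (integrable_const _)
    filter_upwards [hν.abs_bounds] with b hb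
    rw [← sq_abs]
    gcongr
    exact hb.2
  rw [hν.integral_sq] at h
  simp only [integral_const, probReal_univ, one_smul] at h
  exact le_of_sq_le_sq h hν.Gamma_pos.le

lemma IsEntryLaw.hasSubgaussianMGF (hν : IsEntryLaw ν γ Γ σ) :
    HasSubgaussianMGF (fun b : ℝ => b) ((‖Γ - (-Γ)‖₊ / 2) ^ 2) ν := by
  have := hν.isProbabilityMeasure
  refine hasSubgaussianMGF_of_mem_Icc_of_integral_eq_zero aemeasurable_id ?_ hν.mean_eq
  filter_upwards [hν.abs_bounds] with b hb using abs_le.1 hb.2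

variable {ι : Type*} [Fintype ι]

lemma IsEntryLaw.hasSubgaussianMGF_sum (hν : IsEntryLaw ν γ Γ σ) (w : ι → ℝ) :
    HasSubgaussianMGF (fun ξ : ι → ℝ => ∑ j, w j * ξ j)
      (Real.toNNReal ((∑ j, w j ^ 2) * Γ ^ 2)) (Measure.pi fun _ => ν) := by
  have := hν.isProbabilityMeasure
  have hind : iIndepFun (fun (j : ι) (ξ : ι → ℝ) => w j * ξ j) (Measure.pi fun _ => ν) :=
    iIndepFun_pi (X := fun j (b : ℝ) => w j * b) (fun j => by fun_prop)
  obtain ⟨q, hq, hsub⟩ : ∃ q : ι → NNReal, (∀ j, (q j : ℝ) = w j ^ 2) ∧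
      ∀ j ∈ Finset.univ, HasSubgaussianMGF (fun ξ : ι → ℝ => w j * ξ j)
        (q j * (‖Γ - (-Γ)‖₊ / 2) ^ 2) (Measure.pi fun _ => ν) := by
    refine ⟨fun j => ⟨w j ^ 2, sq_nonneg _⟩, fun _ => rfl, fun j _ => ?_⟩
    have h0 : (Measure.pi fun _ : ι => ν).map (fun ξ => ξ j) = ν :=
      (measurePreserving_eval (fun _ : ι => ν) j).map_eq
    have h1 : HasSubgaussianMGF (fun b : ℝ => b) ((‖Γ - (-Γ)‖₊ / 2) ^ 2)
        ((Measure.pi fun _ : ι => ν).map (fun ξ => ξ j)) := by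
      rw [h0]; exact hν.hasSubgaussianMGF
    exact (HasSubgaussianMGF.of_map (X := fun b : ℝ => b) (measurable_pi_apply j).aemeasurable h1).const_mul (w j)
  have h := HasSubgaussianMGF.sum_of_iIndepFun hind hsub
  convert h using 1
  ext
  have hΓ := hν.Gamma_pos
  have h2 : ‖Γ - (-Γ)‖ / 2 = Γ := by
    rw [Real.norm_of_nonneg (by linarith)]; ring
  rw [Real.coe_toNNReal _ (by positivity)]
  push_cast
  rw [Finset.sum_mul]
  refine Finset.sum_congr rfl fun j _ => ?_
  rw [h2, hq]

lemma IsEntryLaw.integral_sum_sq (hν : IsEntryLaw ν γ Γ σ) (w : ι → ℝ) :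
    ∫ ξ : ι → ℝ, (∑ j, w j * ξ j) ^ 2 ∂(Measure.pi fun _ => ν) = σ ^ 2 * ∑ j, w j ^ 2 := by
  have := hν.isProbabilityMeasure
  have hL : MemLp (fun b : ℝ => b) 2 ν := by simpa using hν.hasSubgaussianMGF.memLp 2
  have h0 : ∫ ξ : ι → ℝ, ∑ j, w j * ξ j ∂(Measure.pi fun _ => ν) = 0 := by
    rw [integral_finsetSum]
    · refine Finset.sum_eq_zero fun j _ => ?_
      rw [integral_const_mul, integral_comp_eval (μ := fun _ : ι => ν) (f := fun b : ℝ => b)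
        aestronglyMeasurable_id, hν.mean_eq, mul_zero]
    · exact fun j _ => (integrable_comp_eval (μ := fun _ : ι => ν) (i := j) (f := fun b : ℝ => b)
        (hL.integrable (by norm_num))).const_mul _
  have hm : Measurable fun ξ : ι → ℝ => ∑ j, w j * ξ j := by fun_prop
  rw [← variance_of_integral_eq_zero hm.aemeasurable h0]
  have h1 := variance_sum_pi (μ := fun _ : ι => ν) (X := fun j (b : ℝ) => w j * b)
    (fun j => hL.const_mul _)
  have h2 : (∑ j, fun ξ : ι → ℝ => w j * ξ j) = fun ξ => ∑ j, w j * ξ j := by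
    ext ξ; simp
  rw [← h2, h1, Finset.mul_sum]
  refine Finset.sum_congr rfl fun j _ => ?_
  rw [variance_const_mul, hν.variance_eq, mul_comm]

/-- Upper exponential moment at the scale `σ² / (256 Γ⁴)`. -/
lemma IsEntryLaw.lintegral_exp_sum_sq_le (hν : IsEntryLaw ν γ Γ σ) {w : ι → ℝ}
    (hw : ∑ j, w j ^ 2 ≤ 1) :
    ∫⁻ ξ : ι → ℝ, ENNReal.ofReal (Real.exp (σ ^ 2 / (256 * Γ ^ 4) * (∑ j, w j * ξ j) ^ 2))
      ∂(Measure.pi fun _ => ν) ≤ ENNReal.ofReal (1 + 2 * (σ ^ 2 / (256 * Γ ^ 4)) * σ ^ 2) := by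
  have := hν.isProbabilityMeasure
  have hΓ := hν.Gamma_pos
  have hσ := hν.sigma_pos
  have hσΓ := hν.sigma_le
  have ha : 0 ≤ ∑ j, w j ^ 2 := by positivity
  refine (lintegral_exp_mul_sq_le (hν.hasSubgaussianMGF_sum w) (by fun_prop) (v := Γ ^ 2)
    (by positivity) ?_ (by positivity) ?_).trans (ENNReal.ofReal_le_ofReal ?_)
  · rw [Real.coe_toNNReal _ (by positivity)]
    nlinarith [sq_nonneg Γ]
  · rw [div_le_div_iff₀ (by positivity) (by positivity)]
    have : σ ^ 2 ≤ Γ ^ 2 := by gcongr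
    nlinarith [pow_pos hΓ 2]
  · rw [hν.integral_sum_sq]
    set s := σ ^ 2 / (256 * Γ ^ 4) with hs
    have hs0 : 0 < s := by positivity
    have h1 : 256 * s ^ 2 * (Γ ^ 2) ^ 2 = s * σ ^ 2 := by rw [hs]; field_simp
    rw [h1]
    have : s * (σ ^ 2 * ∑ j, w j ^ 2) ≤ s * (σ ^ 2 * 1) := by gcongr
    linarith

/-- Lower exponential moment at the scale `σ² / (256 Γ⁴)`. -/
lemma IsEntryLaw.lintegral_exp_neg_sum_sq_le (hν : IsEntryLaw ν γ Γ σ) {w : ι → ℝ}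
    (hw : ∑ j, w j ^ 2 ≤ 1) :
    ∫⁻ ξ : ι → ℝ, ENNReal.ofReal (Real.exp (-(σ ^ 2 / (256 * Γ ^ 4) * (∑ j, w j * ξ j) ^ 2)))
      ∂(Measure.pi fun _ => ν) ≤
      ENNReal.ofReal (1 - 7 / 8 * (σ ^ 2 / (256 * Γ ^ 4)) * σ ^ 2 * ∑ j, w j ^ 2) := by
  have := hν.isProbabilityMeasure
  have hΓ := hν.Gamma_pos
  have hσ := hν.sigma_pos
  have ha : 0 ≤ ∑ j, w j ^ 2 := by positivity
  rcases ha.eq_or_lt with h0 | h0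
  · have h1 : ∀ j, w j = 0 := by
      intro j
      have := (Finset.sum_eq_zero_iff_of_nonneg (fun j _ => sq_nonneg (w j))).1 h0.symm j
        (Finset.mem_univ _)
      exact pow_eq_zero_iff (two_ne_zero) |>.1 this
    simp [h1]
  refine (lintegral_exp_neg_mul_sq_le (hν.hasSubgaussianMGF_sum w) (by fun_prop)
    (v := (∑ j, w j ^ 2) * Γ ^ 2)
    (by positivity) ?_ (by positivity)).trans (ENNReal.ofReal_le_ofReal ?_)
  · rw [Real.coe_toNNReal _ (by positivity)]
  · rw [hν.integral_sum_sq]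
    set a := ∑ j, w j ^ 2
    set s := σ ^ 2 / (256 * Γ ^ 4) with hs
    have hs0 : 0 < s := by positivity
    have h1 : 32 * s ^ 2 * (a * Γ ^ 2) ^ 2 = s * σ ^ 2 * a * a / 8 := by rw [hs]; field_simp; ring
    rw [h1]
    have h2 : s * σ ^ 2 * a * a ≤ s * σ ^ 2 * a * 1 := by gcongr
    linarith

end LinearForm

/-! ### Nets on the unit sphere -/

section Net

variable {E : Type*} [NormedAddCommGroup E] [NormedSpace ℝ E] [FiniteDimensional ℝ E]

/-- Volume comparison: the balls of radius `ε / 2` around the points are disjoint and contained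
in the ball of radius `1 + ε / 2`. -/
lemma card_le_of_separated_unitBall {ε : ℝ} (hε : 0 < ε) (s : Finset E) (hs : ∀ c ∈ s, ‖c‖ ≤ 1)
    (h : ∀ c ∈ s, ∀ d ∈ s, c ≠ d → ε ≤ ‖c - d‖) :
    (s.card : ℝ) ≤ (1 + 2 / ε) ^ Module.finrank ℝ E := by
  borelize E
  let μ : Measure E := Measure.addHaar
  have hδ : 0 < ε / 2 := by positivity
  have hρ : 0 < 1 + ε / 2 := by positivity
  set A := ⋃ c ∈ s, Metric.ball (c : E) (ε / 2) with hA
  have D : Set.Pairwise (s : Set E) (Function.onFun Disjoint fun c => Metric.ball (c : E) (ε / 2)) := by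
    rintro c hc d hd hcd
    apply Metric.ball_disjoint_ball
    rw [dist_eq_norm]
    linarith [h c hc d hd hcd]
  have A_subset : A ⊆ Metric.ball (0 : E) (1 + ε / 2) := by
    refine Set.iUnion₂_subset fun x hx => ?_
    apply Metric.ball_subset_ball'
    rw [dist_zero_right]
    linarith [hs x hx]
  have I : (s.card : ENNReal) * ENNReal.ofReal ((ε / 2) ^ Module.finrank ℝ E) *
      μ (Metric.ball 0 1) ≤
      ENNReal.ofReal ((1 + ε / 2) ^ Module.finrank ℝ E) * μ (Metric.ball 0 1) :=
    calc
      _ = μ A := by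
        rw [hA, measure_biUnion_finset D fun c _ => measurableSet_ball]
        simp only [μ.addHaar_ball_of_pos _ hδ]
        simp only [Finset.sum_const, nsmul_eq_mul, mul_assoc]
      _ ≤ μ (Metric.ball (0 : E) (1 + ε / 2)) := measure_mono A_subset
      _ = _ := by simp only [μ.addHaar_ball_of_pos _ hρ]
  have J := (ENNReal.mul_le_mul_iff_left (Metric.measure_ball_pos _ _ zero_lt_one).ne'
    measure_ball_lt_top.ne).1 I
  have K := ENNReal.toReal_le_of_le_ofReal (pow_nonneg hρ.le _) J
  rw [ENNReal.toReal_mul, ENNReal.toReal_ofReal (by positivity), ENNReal.toReal_natCast,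
    ← le_div_iff₀ (by positivity), ← div_pow] at K
  have hquot : (1 + ε / 2) / (ε / 2) = 1 + 2 / ε := by
    field_simp
    ring
  rwa [hquot] at K

lemma exists_net_unitSphere {ε : ℝ} (hε : 0 < ε) :
    ∃ N : Finset E, (∀ v ∈ N, ‖v‖ = 1) ∧ (∀ u : E, ‖u‖ = 1 → ∃ v ∈ N, ‖u - v‖ ≤ ε) ∧
      (N.card : ℝ) ≤ (1 + 2 / ε) ^ Module.finrank ℝ E := by
  classical
  let sep : Finset E → Prop := fun s =>
    (∀ v ∈ s, ‖v‖ = 1) ∧ ∀ c ∈ s, ∀ d ∈ s, c ≠ d → ε ≤ ‖c - d‖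
  have hcard : ∀ s, sep s → (s.card : ℝ) ≤ (1 + 2 / ε) ^ Module.finrank ℝ E := fun s hs =>
    card_le_of_separated_unitBall hε s (fun c hc => (hs.1 c hc).le) hs.2
  set K : Set ℕ := {k | ∃ s, sep s ∧ s.card = k} with hK
  have hne : K.Nonempty := ⟨0, ∅, by simp [sep], rfl⟩
  have hbdd : BddAbove K := by
    refine ⟨⌊(1 + 2 / ε) ^ Module.finrank ℝ E⌋₊, ?_⟩
    rintro _ ⟨s, hs, rfl⟩
    exact Nat.le_floor (hcard s hs)
  obtain ⟨N, hN, hNK⟩ := Nat.sSup_mem hne hbdd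
  refine ⟨N, hN.1, fun u hu => ?_, hcard N hN⟩
  -- A separated set of maximal cardinality is a net: a point far from it could be added.
  by_contra! hcon
  have huN : u ∉ N := fun h => by
    have := hcon u h
    simp only [sub_self, norm_zero] at this
    linarith
  have hins : sep (insert u N) := by
    refine ⟨fun v hv => ?_, fun c hc d hd hcd => ?_⟩
    · rcases Finset.mem_insert.1 hv with rfl | hv
      exacts [hu, hN.1 v hv]
    · rcases Finset.mem_insert.1 hc with hcu | hc <;>
        rcases Finset.mem_insert.1 hd with hdu | hd
      · exact absurd (hcu.trans hdu.symm) hcd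
      · rw [hcu]; exact (hcon d hd).le
      · rw [hdu, norm_sub_rev]; exact (hcon c hc).le
      · exact hN.2 c hc d hd hcd
  have := le_csSup hbdd (show (insert u N).card ∈ K from ⟨_, hins, rfl⟩)
  rw [Finset.card_insert_of_notMem huN, ← hNK] at this
  omega

end Net

/-! ### Moments of the random code -/

lemma lintegral_codeLaw (n k : ℕ) (ν : Measure ℝ) {f : (Fin n → ℝ) → ENNReal}
    (hf : Measurable f) :
    ∫⁻ b, f b ∂(codeLaw n k ν) = ((n.choose k : ENNReal)⁻¹) *
      ∑ S ∈ Finset.powersetCard k (Finset.univ : Finset (Fin n)),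
        ∫⁻ ξ, f (fun i => if i ∈ S then ξ i else 0) ∂(Measure.pi fun _ => ν) := by
  rw [codeLaw, lintegral_smul_measure, lintegral_finsetSum_measure, smul_eq_mul]
  congr 1
  refine Finset.sum_congr rfl fun S _ => ?_
  rw [lintegral_map hf]
  refine measurable_pi_lambda _ fun i => ?_
  split_ifs
  · fun_prop
  · fun_prop

lemma lintegral_codeLaw_le {n k : ℕ} (hk : k ≤ n) (ν : Measure ℝ) {f : (Fin n → ℝ) → ENNReal}
    (hf : Measurable f) {c : Finset (Fin n) → ℝ} (hc : ∀ S, 0 ≤ c S)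
    (h : ∀ S : Finset (Fin n), ∫⁻ ξ, f (fun i => if i ∈ S then ξ i else 0) ∂(Measure.pi fun _ => ν) ≤
      ENNReal.ofReal (c S)) :
    ∫⁻ b, f b ∂(codeLaw n k ν) ≤ ENNReal.ofReal ((n.choose k : ℝ)⁻¹ *
      ∑ S ∈ Finset.powersetCard k (Finset.univ : Finset (Fin n)), c S) := by
  have hpos : (0 : ℝ) < n.choose k := by exact_mod_cast Nat.choose_pos hk
  rw [lintegral_codeLaw n k ν hf, ENNReal.ofReal_mul (by positivity),
    ENNReal.ofReal_inv_of_pos hpos, ENNReal.ofReal_natCast,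
    ENNReal.ofReal_sum_of_nonneg (fun S _ => hc S)]
  gcongr with S _
  exact h S

lemma ae_codeLaw {n k : ℕ} {ν : Measure ℝ} {γ Γ σ : ℝ} (hν : IsEntryLaw ν γ Γ σ) :
    ∀ᵐ b ∂(codeLaw n k ν), ∃ S : Finset (Fin n), S.card = k ∧
      (∀ j ∈ S, γ ≤ |b j| ∧ |b j| ≤ Γ) ∧ ∀ j ∉ S, b j = 0 := by
  have := hν.isProbabilityMeasure
  have hmeas : MeasurableSet {b : Fin n → ℝ | ∃ S : Finset (Fin n), S.card = k ∧
      (∀ j ∈ S, γ ≤ |b j| ∧ |b j| ≤ Γ) ∧ ∀ j ∉ S, b j = 0} := by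
    have hset : {b : Fin n → ℝ | ∃ S : Finset (Fin n), S.card = k ∧
        (∀ j ∈ S, γ ≤ |b j| ∧ |b j| ≤ Γ) ∧ ∀ j ∉ S, b j = 0} =
        ⋃ S : Finset (Fin n), ⋃ _ : S.card = k,
          ((⋂ j, ⋂ _ : j ∈ S, {b | γ ≤ |b j|} ∩ {b | |b j| ≤ Γ}) ∩
            ⋂ j, ⋂ _ : j ∉ S, {b | b j = 0}) := by
      ext b; simp [and_left_comm]
    rw [hset]
    refine MeasurableSet.iUnion fun S => MeasurableSet.iUnion fun _ => MeasurableSet.inter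
      (MeasurableSet.iInter fun j => MeasurableSet.iInter fun _ => MeasurableSet.inter ?_ ?_)
      (MeasurableSet.iInter fun j => MeasurableSet.iInter fun _ => ?_)
    · exact measurableSet_le (by fun_prop) (by fun_prop)
    · exact measurableSet_le (by fun_prop) (by fun_prop)
    · exact measurableSet_eq_fun (by fun_prop) (by fun_prop)
  rw [ae_iff, ← Set.compl_ofPred, ← lintegral_indicator_one hmeas.compl,
    lintegral_codeLaw _ _ _ (measurable_one.indicator hmeas.compl)]
  rw [mul_eq_zero]
  right
  refine Finset.sum_eq_zero fun S hS => ?_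
  rw [lintegral_eq_zero_of_ae_eq_zero]
  have hall : ∀ᵐ ξ : Fin n → ℝ ∂(Measure.pi fun _ => ν), ∀ j, γ ≤ |ξ j| ∧ |ξ j| ≤ Γ := by
    rw [ae_all_iff]
    intro j
    exact (measurePreserving_eval (fun _ : Fin n => ν) j).quasiMeasurePreserving.ae hν.abs_bounds
  filter_upwards [hall] with ξ hξ
  rw [Set.indicator_of_notMem]
  · rfl
  · rw [Set.notMem_compl_iff]
    refine ⟨S, (Finset.mem_powersetCard.1 hS).2, fun j hj => ?_, fun j hj => ?_⟩
    · simpa [hj] using hξ j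
    · simp [hj]

/-- The probability that a uniform `k`-subset contains both `i` and `j` is at least
`k (k - 1) / n²`. -/
lemma le_card_filter_mem_mem {n k : ℕ} (hk : 1 ≤ k) (i j : Fin n) :
    (k : ℝ) * ((k : ℝ) - 1) * (n.choose k : ℝ) ≤ (n : ℝ) ^ 2 *
      (((Finset.powersetCard k (Finset.univ : Finset (Fin n))).filter
        (fun S => i ∈ S ∧ j ∈ S)).card : ℝ) := by
  have hfil : (Finset.powersetCard k (Finset.univ : Finset (Fin n))).filter
        (fun S => i ∈ S ∧ j ∈ S) =
      (Finset.powersetCard k (Finset.univ : Finset (Fin n))).filter (({i, j} : Finset (Fin n)) ⊆ ·) := by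
    ext S; simp [Finset.insert_subset_iff]
  have hn : 1 ≤ n := Nat.one_le_of_lt i.2
  obtain ⟨k, rfl⟩ : ∃ k', k = k' + 1 := ⟨k - 1, by omega⟩
  obtain ⟨n, rfl⟩ : ∃ n', n = n' + 1 := ⟨n - 1, by omega⟩
  have h1 : ((n : ℝ) + 1) * (n.choose k : ℝ) = ((n + 1).choose (k + 1) : ℝ) * ((k : ℝ) + 1) := by
    exact_mod_cast Nat.add_one_mul_choose_eq n k
  by_cases hij : i = j
  · subst hij
    rw [hfil, Finset.card_filter_powersetCard_subset _ _ _ (Finset.subset_univ _) (by simp)]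
    simp only [Finset.pair_eq_singleton, Finset.card_univ, Fintype.card_fin, Finset.card_singleton,
      Nat.add_sub_cancel]
    push_cast
    rcases le_or_gt k n with hkn | hkn
    · have : (k : ℝ) ≤ n := by exact_mod_cast hkn
      have h0 : (0 : ℝ) ≤ n.choose k := by positivity
      calc ((k : ℝ) + 1) * ((k : ℝ) + 1 - 1) * ((n + 1).choose (k + 1) : ℝ)
          = k * (((n : ℝ) + 1) * (n.choose k : ℝ)) := by rw [h1]; ring
        _ ≤ (n + 1) * (((n : ℝ) + 1) * (n.choose k : ℝ)) := by gcongr; linarith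
        _ = _ := by ring
    · rw [Nat.choose_eq_zero_of_lt (by omega : n + 1 < k + 1)]
      simp only [Nat.cast_zero, mul_zero]
      positivity
  · rcases Nat.eq_zero_or_pos k with rfl | hk0
    · simp only [zero_add, Nat.cast_one, sub_self, mul_zero, zero_mul]
      positivity
    have hn0 : 0 < n := by
      rcases Nat.eq_zero_or_pos n with rfl | h
      · exact absurd (Fin.ext (by omega)) hij
      · exact h
    rw [hfil, Finset.card_filter_powersetCard_subset _ _ _ (Finset.subset_univ _)
      (by rw [Finset.card_pair hij]; omega), Finset.card_pair hij]
    obtain ⟨k, rfl⟩ : ∃ k', k = k' + 1 := ⟨k - 1, by omega⟩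
    obtain ⟨n, rfl⟩ : ∃ n', n = n' + 1 := ⟨n - 1, by omega⟩
    have h2 : ((n : ℝ) + 1) * (n.choose k : ℝ) = ((n + 1).choose (k + 1) : ℝ) * ((k : ℝ) + 1) := by
      exact_mod_cast Nat.add_one_mul_choose_eq n k
    simp only [Finset.card_univ, Fintype.card_fin]
    have e1 : n + 1 + 1 - 2 = n := by omega
    have e2 : k + 1 + 1 - 2 = k := by omega
    rw [e1, e2]
    push_cast at h1 ⊢
    have h0 : (0 : ℝ) ≤ n.choose k := by positivity
    have h3 : ((k : ℝ) + 1 + 1) * ((k : ℝ) + 1 + 1 - 1) * ((n + 1 + 1).choose (k + 1 + 1) : ℝ) =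
        ((n : ℝ) + 1 + 1) * ((n : ℝ) + 1) * (n.choose k : ℝ) := by
      calc _ = (((n + 1 + 1).choose (k + 1 + 1) : ℝ) * ((k : ℝ) + 1 + 1)) * ((k : ℝ) + 1) := by ring
        _ = ((n : ℝ) + 1 + 1) * (((n + 1).choose (k + 1) : ℝ) * ((k : ℝ) + 1)) := by
            rw [← h1]; ring
        _ = _ := by rw [← h2]; ring
    rw [h3, sq]
    gcongr
    linarith

lemma le_sum_powersetCard {n k : ℕ} (hk : 1 ≤ k) (i : Fin n) {a : Fin n → ℝ} (ha : ∀ j, 0 ≤ a j) :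
    (k : ℝ) * ((k : ℝ) - 1) * (n.choose k : ℝ) * ∑ j, a j ≤ (n : ℝ) ^ 2 *
      ∑ S ∈ Finset.powersetCard k (Finset.univ : Finset (Fin n)),
        if i ∈ S then ∑ j, (if j ∈ S then a j else 0) else 0 := by
  have hswap : ∑ S ∈ Finset.powersetCard k (Finset.univ : Finset (Fin n)),
        (if i ∈ S then ∑ j, (if j ∈ S then a j else 0) else 0) =
      ∑ j, (((Finset.powersetCard k (Finset.univ : Finset (Fin n))).filter
        (fun S => i ∈ S ∧ j ∈ S)).card : ℝ) * a j := by
    have : ∀ S : Finset (Fin n), (if i ∈ S then ∑ j, (if j ∈ S then a j else 0) else 0) =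
        ∑ j, if i ∈ S ∧ j ∈ S then a j else 0 := by
      intro S
      by_cases h : i ∈ S <;> simp [h]
    simp_rw [this]
    rw [Finset.sum_comm]
    refine Finset.sum_congr rfl fun j _ => ?_
    rw [← Finset.sum_filter, Finset.sum_const, nsmul_eq_mul]
  rw [hswap, Finset.mul_sum, Finset.mul_sum]
  refine Finset.sum_le_sum fun j _ => ?_
  rw [← mul_assoc]
  exact mul_le_mul_of_nonneg_right (le_card_filter_mem_mem hk i j) (ha j)

section CodeMoments

variable {ν : Measure ℝ} {γ Γ σ : ℝ} {n k : ℕ}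

lemma sum_mul_mask (u ξ : Fin n → ℝ) (S : Finset (Fin n)) :
    ∑ j, u j * (if j ∈ S then ξ j else 0) = ∑ j, (if j ∈ S then u j else 0) * ξ j := by
  refine Finset.sum_congr rfl fun j _ => ?_
  split_ifs <;> simp

lemma sum_mask_sq (u : Fin n → ℝ) (S : Finset (Fin n)) :
    ∑ j, (if j ∈ S then u j else 0) ^ 2 = ∑ j, if j ∈ S then u j ^ 2 else 0 := by
  refine Finset.sum_congr rfl fun j _ => ?_
  split_ifs <;> simp

lemma sum_mask_sq_le (u : Fin n → ℝ) (S : Finset (Fin n)) :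
    ∑ j, (if j ∈ S then u j else 0) ^ 2 ≤ ∑ j, u j ^ 2 := by
  refine Finset.sum_le_sum fun j _ => ?_
  split_ifs
  · exact le_rfl
  · simp [sq_nonneg]

lemma lintegral_codeLaw_exp_sq_le (hν : IsEntryLaw ν γ Γ σ) (hk : k ≤ n) {u : Fin n → ℝ}
    (hu : ∑ j, u j ^ 2 ≤ 1) :
    ∫⁻ b, ENNReal.ofReal (Real.exp (σ ^ 2 / (256 * Γ ^ 4) * (∑ j, u j * b j) ^ 2))
      ∂(codeLaw n k ν) ≤
      ENNReal.ofReal (Real.exp (2 * (σ ^ 2 / (256 * Γ ^ 4)) * σ ^ 2)) := by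
  have hΓ := hν.Gamma_pos
  have hpos : (0 : ℝ) < n.choose k := by exact_mod_cast Nat.choose_pos hk
  refine (lintegral_codeLaw_le hk ν (by fun_prop)
    (c := fun _ => 1 + 2 * (σ ^ 2 / (256 * Γ ^ 4)) * σ ^ 2)
    (fun _ => by positivity) (fun S => ?_)).trans (ENNReal.ofReal_le_ofReal ?_)
  · simp_rw [sum_mul_mask]
    exact hν.lintegral_exp_sum_sq_le ((sum_mask_sq_le u S).trans hu)
  · rw [Finset.sum_const, Finset.card_powersetCard, Finset.card_univ, Fintype.card_fin,
      nsmul_eq_mul, inv_mul_cancel_left₀ hpos.ne', add_comm]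
    exact Real.add_one_le_exp _

lemma lintegral_codeLaw_exp_neg_sq_le (hν : IsEntryLaw ν γ Γ σ) (hk1 : 1 ≤ k) (hk : k ≤ n)
    (i : Fin n) {u : Fin n → ℝ} (hu : ∑ j, u j ^ 2 = 1) :
    ∫⁻ b, ENNReal.ofReal (Real.exp (-(σ ^ 2 / (256 * Γ ^ 4) *
        (if b i ≠ 0 then (∑ j, u j * b j) ^ 2 else 0)))) ∂(codeLaw n k ν) ≤
      ENNReal.ofReal (Real.exp (-(7 / 8 * (σ ^ 2 / (256 * Γ ^ 4)) *
        (σ ^ 2 * (k * (k - 1) / n ^ 2))))) := by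
  have := hν.isProbabilityMeasure
  have hΓ := hν.Gamma_pos
  have hσ := hν.sigma_pos
  have hσΓ := hν.sigma_le
  have hpos : (0 : ℝ) < n.choose k := by exact_mod_cast Nat.choose_pos hk
  have hn : (0 : ℝ) < n := by exact_mod_cast (hk1.trans hk)
  set s := σ ^ 2 / (256 * Γ ^ 4) with hs
  have hs0 : 0 < s := by positivity
  have hsσ : s * σ ^ 2 ≤ 1 := by
    rw [hs, div_mul_eq_mul_div, div_le_one (by positivity)]
    have : σ ^ 4 ≤ Γ ^ 4 := by gcongr
    nlinarith [pow_pos hΓ 4]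
  have hi : ∀ᵐ ξ : Fin n → ℝ ∂(Measure.pi fun _ => ν), ξ i ≠ 0 := by
    have h0 : ∀ᵐ b ∂ν, b ≠ 0 := by
      filter_upwards [hν.abs_bounds] with b hb
      exact abs_pos.1 (hν.gamma_pos.trans_le hb.1)
    exact (measurePreserving_eval (fun _ : Fin n => ν) i).quasiMeasurePreserving.ae h0
  refine (lintegral_codeLaw_le hk ν ?_
    (c := fun S => 1 - 7 / 8 * s * σ ^ 2 *
      (if i ∈ S then ∑ j, (if j ∈ S then u j ^ 2 else 0) else 0))
    (fun S => ?_) (fun S => ?_)).trans (ENNReal.ofReal_le_ofReal ?_)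
  · have : Measurable fun b : Fin n → ℝ => if b i ≠ 0 then (∑ j, u j * b j) ^ 2 else 0 := by
      refine Measurable.ite ?_ (by fun_prop) measurable_const
      exact (measurableSet_eq_fun (measurable_pi_apply i) measurable_const).compl
    fun_prop
  · have h1 : (if i ∈ S then ∑ j, (if j ∈ S then u j ^ 2 else 0) else 0) ≤ 1 := by
      split_ifs
      · rw [← sum_mask_sq]; exact (sum_mask_sq_le u S).trans hu.le
      · norm_num
    have h2 : 7 / 8 * s * σ ^ 2 * (if i ∈ S then ∑ j, (if j ∈ S then u j ^ 2 else 0) else 0) ≤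
        7 / 8 * s * σ ^ 2 * 1 := by gcongr
    linarith
  · by_cases hiS : i ∈ S
    · simp only [hiS, if_true]
      have h3 := hν.lintegral_exp_neg_sum_sq_le (w := fun j => if j ∈ S then u j else 0)
        ((sum_mask_sq_le u S).trans hu.le)
      rw [sum_mask_sq] at h3
      refine (lintegral_congr_ae ?_).trans_le h3
      filter_upwards [hi] with ξ hξ
      rw [if_pos hξ, sum_mul_mask]
    · simp [hiS]
  · have h4 := le_sum_powersetCard (k := k) hk1 i (a := fun j => u j ^ 2) (fun j => sq_nonneg _)
    rw [hu, mul_one] at h4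
    rw [Finset.sum_sub_distrib, ← Finset.mul_sum, Finset.sum_const, Finset.card_powersetCard,
      Finset.card_univ, Fintype.card_fin, nsmul_eq_mul, mul_one, mul_sub,
      inv_mul_cancel₀ hpos.ne']
    set T := ∑ S ∈ Finset.powersetCard k (Finset.univ : Finset (Fin n)),
        if i ∈ S then ∑ j, (if j ∈ S then u j ^ 2 else 0) else 0
    have h5 : (k : ℝ) * (k - 1) / n ^ 2 ≤ (n.choose k : ℝ)⁻¹ * T := by
      rw [inv_mul_eq_div, div_le_div_iff₀ (by positivity) hpos]
      linarith
    have h6 : 7 / 8 * s * σ ^ 2 * ((k : ℝ) * (k - 1) / n ^ 2) ≤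
        7 / 8 * s * σ ^ 2 * ((n.choose k : ℝ)⁻¹ * T) := by gcongr
    have h7 := Real.add_one_le_exp (-(7 / 8 * s * (σ ^ 2 * ((k : ℝ) * (k - 1) / n ^ 2))))
    linarith

end CodeMoments

/-! ### Chernoff bound -/

lemma measure_sum_ge_le_of_lintegral_exp_le {Ω α : Type*} [MeasurableSpace Ω] [MeasurableSpace α]
    {μ : Measure Ω} {P : Measure α} {m : ℕ} {β : Fin m → Ω → α}
    (hind : iIndepFun β μ) (hlaw : ∀ h, HasLaw (β h) P μ) {g : α → ℝ} (hg : Measurable g) {r : ℝ}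
    (hr : ∫⁻ b, ENNReal.ofReal (Real.exp (g b)) ∂P ≤ ENNReal.ofReal (Real.exp r)) (a : ℝ) :
    μ {ω | a ≤ ∑ h, g (β h ω)} ≤ ENNReal.ofReal (Real.exp (m * r - a)) := by
  set G : α → ENNReal := fun b => ENNReal.ofReal (Real.exp (g b)) with hG
  have hGm : Measurable G := by fun_prop
  set Y : Fin m → Ω → α := fun h => (hlaw h).aemeasurable.mk (β h) with hY
  have hYae : ∀ h, β h =ᵐ[μ] Y h := fun h => (hlaw h).aemeasurable.ae_eq_mk
  have hYm : ∀ h, Measurable (Y h) := fun h => (hlaw h).aemeasurable.measurable_mk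
  have hYind : iIndepFun (fun h => G ∘ Y h) μ := (hind.congr hYae).comp (fun _ => G) fun _ => hGm
  have hprod : ∫⁻ ω, ∏ h, G (Y h ω) ∂μ ≤ ENNReal.ofReal (Real.exp (m * r)) := by
    have h1 := lintegral_prod_eq_prod_lintegral_of_indepFun Finset.univ (fun h => G ∘ Y h) hYind
      (fun h => hGm.comp (hYm h))
    simp only [Function.comp_apply] at h1
    rw [h1]
    have h2 : ∀ h, ∫⁻ ω, G (Y h ω) ∂μ ≤ ENNReal.ofReal (Real.exp r) := by
      intro h
      have h3 : ∫⁻ ω, G (Y h ω) ∂μ = ∫⁻ b, G b ∂P := by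
        rw [← (hlaw h).map_eq, lintegral_map' hGm.aemeasurable (hlaw h).aemeasurable]
        refine lintegral_congr_ae ?_
        filter_upwards [hYae h] with ω hω
        rw [hω]
      rw [h3]
      exact hr
    refine (Finset.prod_le_prod' fun h _ => h2 h).trans ?_
    rw [Finset.prod_const, Finset.card_univ, Fintype.card_fin,
      ← ENNReal.ofReal_pow (Real.exp_pos _).le, ← Real.exp_nat_mul]
  have hsub : μ {ω | a ≤ ∑ h, g (β h ω)} ≤
      μ {ω | ENNReal.ofReal (Real.exp a) ≤ ∏ h, G (Y h ω)} := by
    refine measure_mono_ae ?_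
    filter_upwards [ae_all_iff.2 hYae] with ω hω hle
    have hle' : a ≤ ∑ h, g (β h ω) := hle
    change ENNReal.ofReal (Real.exp a) ≤ ∏ h, G (Y h ω)
    rw [hG, ← ENNReal.ofReal_prod_of_nonneg (fun h _ => (Real.exp_pos _).le), ← Real.exp_sum]
    refine ENNReal.ofReal_le_ofReal (Real.exp_le_exp.2 ?_)
    simpa only [hω] using hle'
  refine hsub.trans ?_
  have hmk := mul_meas_ge_le_lintegral (μ := μ)
    (Finset.measurable_prod Finset.univ fun h _ => hGm.comp (hYm h)) (ENNReal.ofReal (Real.exp a))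
  simp only [Function.comp_apply] at hmk
  have h0 : ENNReal.ofReal (Real.exp a) ≠ 0 := by
    rw [Ne, ENNReal.ofReal_eq_zero, not_le]; exact Real.exp_pos a
  rw [Real.exp_sub, ENNReal.ofReal_div_of_pos (Real.exp_pos a),
    ENNReal.le_div_iff_mul_le (Or.inl h0) (Or.inl ENNReal.ofReal_ne_top), mul_comm]
  exact hmk.trans hprod

/-! ### Uniform two-sided bounds for the empirical quadratic forms -/

section NetTransfer

variable {E ι : Type*} [NormedAddCommGroup E] [NormedSpace ℝ E] [Fintype ι]

lemma sum_sq_map_le_two_mul (ℓ : ι → E →L[ℝ] ℝ) (u v : E) :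
    ∑ h, (ℓ h u) ^ 2 ≤ 2 * ∑ h, (ℓ h v) ^ 2 + 2 * ∑ h, (ℓ h (u - v)) ^ 2 := by
  rw [Finset.mul_sum, Finset.mul_sum, ← Finset.sum_add_distrib]
  refine Finset.sum_le_sum fun h _ => ?_
  rw [map_sub]
  nlinarith [sq_nonneg (ℓ h u - 2 * ℓ h v)]

lemma sum_sq_map_le_of_le_on_sphere (ℓ : ι → E →L[ℝ] ℝ) {A : ℝ}
    (h : ∀ u : E, ‖u‖ = 1 → ∑ h, (ℓ h u) ^ 2 ≤ A) (u : E) :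
    ∑ h, (ℓ h u) ^ 2 ≤ A * ‖u‖ ^ 2 := by
  rcases eq_or_ne u 0 with rfl | hu
  · simp
  have hu' := norm_pos_iff.2 hu
  have h1 := h (‖u‖⁻¹ • u) (by rw [norm_smul, norm_inv, norm_norm, inv_mul_cancel₀ hu'.ne'])
  simp only [map_smul, smul_eq_mul, mul_pow, ← Finset.mul_sum] at h1
  rwa [inv_pow, inv_mul_le_iff₀ (by positivity), mul_comm] at h1

lemma le_sum_sq_map_of_le_on_sphere (ℓ : ι → E →L[ℝ] ℝ) {A : ℝ}
    (h : ∀ u : E, ‖u‖ = 1 → A ≤ ∑ h, (ℓ h u) ^ 2) (u : E) :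
    A * ‖u‖ ^ 2 ≤ ∑ h, (ℓ h u) ^ 2 := by
  rcases eq_or_ne u 0 with rfl | hu
  · simp
  have hu' := norm_pos_iff.2 hu
  have h1 := h (‖u‖⁻¹ • u) (by rw [norm_smul, norm_inv, norm_norm, inv_mul_cancel₀ hu'.ne'])
  simp only [map_smul, smul_eq_mul, mul_pow, ← Finset.mul_sum] at h1
  rwa [inv_pow, le_inv_mul_iff₀ (by positivity), mul_comm] at h1

/-- The form at a maximizer `w` on the sphere is at most `2 A` plus twice its value at
`w - v`, where `v` is a net point within `1 / 2` of `w`, and the latter is at most a quarter of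
the maximum. -/
lemma sum_sq_map_le_of_net [FiniteDimensional ℝ E] (ℓ : ι → E →L[ℝ] ℝ) {N : Finset E} {A : ℝ}
    (hN : ∀ u : E, ‖u‖ = 1 → ∃ v ∈ N, ‖u - v‖ ≤ 1 / 2)
    (hA : ∀ v ∈ N, ∑ h, (ℓ h v) ^ 2 ≤ A) (u : E) :
    ∑ h, (ℓ h u) ^ 2 ≤ 4 * A * ‖u‖ ^ 2 := by
  rcases eq_or_ne u 0 with rfl | hu0
  · simp
  have hu' := norm_pos_iff.2 hu0
  have hne : (Metric.sphere (0 : E) 1).Nonempty :=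
    ⟨‖u‖⁻¹ • u, by rw [mem_sphere_zero_iff_norm, norm_smul, norm_inv, norm_norm,
      inv_mul_cancel₀ hu'.ne']⟩
  obtain ⟨w, hw, hmax⟩ := (isCompact_sphere (0 : E) 1).exists_isMaxOn hne
    (f := fun u => ∑ h, (ℓ h u) ^ 2) (by fun_prop)
  rw [mem_sphere_zero_iff_norm] at hw
  have hle : ∀ u : E, ‖u‖ = 1 → ∑ h, (ℓ h u) ^ 2 ≤ ∑ h, (ℓ h w) ^ 2 := fun u hu =>
    hmax (mem_sphere_zero_iff_norm.2 hu)
  obtain ⟨v, hv, hwv⟩ := hN w hw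
  have h1 := sum_sq_map_le_two_mul ℓ w v
  have h2 := sum_sq_map_le_of_le_on_sphere ℓ hle (w - v)
  have h3 := hA v hv
  have h4 : 0 ≤ ∑ h, (ℓ h w) ^ 2 := by positivity
  have h5 : ‖w - v‖ ^ 2 ≤ (1 / 2) ^ 2 := by gcongr
  have h6 := mul_le_mul_of_nonneg_left h5 h4
  refine sum_sq_map_le_of_le_on_sphere ℓ (fun u hu => (hle u hu).trans ?_) u
  linarith

lemma le_sum_sq_map_of_net (ℓ : ι → E →L[ℝ] ℝ) {N : Finset E} {A B ε : ℝ} (hB0 : 0 ≤ B)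
    (hB : ∀ u : E, ∑ h, (ℓ h u) ^ 2 ≤ B * ‖u‖ ^ 2)
    (hN : ∀ u : E, ‖u‖ = 1 → ∃ v ∈ N, ‖u - v‖ ≤ ε)
    (hA : ∀ v ∈ N, A ≤ ∑ h, (ℓ h v) ^ 2) (u : E) :
    (A / 2 - B * ε ^ 2) * ‖u‖ ^ 2 ≤ ∑ h, (ℓ h u) ^ 2 := by
  refine le_sum_sq_map_of_le_on_sphere ℓ (fun u hu => ?_) u
  obtain ⟨v, hv, huv⟩ := hN u hu
  have h1 := sum_sq_map_le_two_mul ℓ v u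
  have h2 := hB (v - u)
  have h3 := hA v hv
  rw [norm_sub_rev] at h2
  have h5 : ‖u - v‖ ^ 2 ≤ ε ^ 2 := by gcongr
  have h6 := mul_le_mul_of_nonneg_left h5 hB0
  linarith

end NetTransfer

/-- The conditions on a sample of codes under which concept refinement contracts: every code
has exactly `k` non-zero entries, all of size in `[γ, Γ]`; the empirical second moment matrix is
at most `16 σ²`; and, for each `i`, the second moment matrix of the codes with `i` in their
support is at least `k (k - 1) σ² / (4 n²)`. Both are stated as
bounds for the associated quadratic forms, summed (not averaged) over the sample. -/
structure IsWellConditioned {m n : ℕ} (k : ℕ) (γ Γ σ : ℝ) (b : Fin m → Fin n → ℝ) : Prop where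
  support : ∀ h, ∃ S : Finset (Fin n), S.card = k ∧
    (∀ j ∈ S, γ ≤ |b h j| ∧ |b h j| ≤ Γ) ∧ ∀ j ∉ S, b h j = 0
  upper : ∀ u : EuclideanSpace ℝ (Fin n),
    ∑ h, (∑ j, u j * b h j) ^ 2 ≤ 16 * σ ^ 2 * m * ‖u‖ ^ 2
  lower : ∀ (i : Fin n) (u : EuclideanSpace ℝ (Fin n)),
    m * (σ ^ 2 * (k * (k - 1) / (4 * n ^ 2))) * ‖u‖ ^ 2 ≤
      ∑ h, if b h i ≠ 0 then (∑ j, u j * b h j) ^ 2 else 0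

/-- The linear form `u ↦ ∑ⱼ uⱼ bⱼ` on Euclidean space. -/
noncomputable def codeForm {n : ℕ} (b : Fin n → ℝ) : EuclideanSpace ℝ (Fin n) →L[ℝ] ℝ :=
  ∑ j, b j • (EuclideanSpace.proj j : EuclideanSpace ℝ (Fin n) →L[ℝ] ℝ)

lemma codeForm_apply {n : ℕ} (b : Fin n → ℝ) (u : EuclideanSpace ℝ (Fin n)) :
    codeForm b u = ∑ j, u j * b j := by
  simp [codeForm, mul_comm]

section Concentration

variable {Ω : Type*} [MeasurableSpace Ω] {μ : Measure Ω} {ν : Measure ℝ} {γ Γ σ κ : ℝ}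
  {n k m : ℕ} {β : Fin m → Ω → Fin n → ℝ}

lemma IsEntryLaw.one_div_le_scale (hν : IsEntryLaw ν γ Γ σ) (hκ : 0 < κ) (hΓκ : Γ ≤ κ * σ) :
    1 / (256 * κ ^ 4) ≤ σ ^ 2 / (256 * Γ ^ 4) * σ ^ 2 := by
  have hΓ := hν.Gamma_pos
  have hσ := hν.sigma_pos
  have h1 : Γ ^ 4 ≤ (κ * σ) ^ 4 := by gcongr
  rw [div_mul_eq_mul_div, div_le_div_iff₀ (by positivity) (by positivity)]
  nlinarith

lemma measure_exists_mem_le {α : Type*} (N : Finset α) (p : α → Ω → Prop) {r : ℝ}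
    (h : ∀ v ∈ N, μ {ω | p v ω} ≤ ENNReal.ofReal r) :
    μ {ω | ∃ v ∈ N, p v ω} ≤ ENNReal.ofReal (N.card * r) := by
  have : {ω | ∃ v ∈ N, p v ω} = ⋃ v ∈ N, {ω | p v ω} := by ext; simp
  rw [this]
  refine (measure_biUnion_finset_le N _).trans ?_
  refine (Finset.sum_le_card_nsmul N _ _ h).trans ?_
  rw [nsmul_eq_mul, ENNReal.ofReal_mul (by positivity), ENNReal.ofReal_natCast]

lemma measure_not_upper_le (hν : IsEntryLaw ν γ Γ σ) (hk : k ≤ n) (hκ : 0 < κ) (hΓκ : Γ ≤ κ * σ)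
    (hind : iIndepFun β μ) (hlaw : ∀ h, HasLaw (β h) (codeLaw n k ν) μ)
    (hm : 768 * κ ^ 4 * n ≤ m) :
    μ {ω | ¬ ∀ u : EuclideanSpace ℝ (Fin n),
      ∑ h, (∑ j, u j * β h ω j) ^ 2 ≤ 16 * σ ^ 2 * m * ‖u‖ ^ 2} ≤
      ENNReal.ofReal (Real.exp (-(2 * n))) := by
  have hΓ := hν.Gamma_pos
  have hσ := hν.sigma_pos
  obtain ⟨N, hN1, hNnet, hNcard⟩ :=
    exists_net_unitSphere (E := EuclideanSpace ℝ (Fin n)) (ε := 1 / 2) (by norm_num)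
  rw [finrank_euclideanSpace_fin] at hNcard
  set s := σ ^ 2 / (256 * Γ ^ 4) with hs
  have hs0 : 0 < s := by positivity
  have hsκ := hν.one_div_le_scale hκ hΓκ
  rw [← hs] at hsκ
  have hv : ∀ v ∈ N, μ {ω | s * (4 * σ ^ 2 * m) ≤ ∑ h, s * (∑ j, v j * β h ω j) ^ 2} ≤
      ENNReal.ofReal (Real.exp (-(6 * n))) := by
    intro v hv
    have hv1 : ∑ j, v j ^ 2 ≤ 1 := by
      rw [← EuclideanSpace.real_norm_sq_eq, hN1 v hv]; norm_num
    refine (measure_sum_ge_le_of_lintegral_exp_le hind hlaw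
      (g := fun b => s * (∑ j, v j * b j) ^ 2) (by fun_prop)
      (lintegral_codeLaw_exp_sq_le hν hk hv1) _).trans
      (ENNReal.ofReal_le_ofReal (Real.exp_le_exp.2 ?_))
    have h1 : (m : ℝ) * (1 / (256 * κ ^ 4)) ≤ m * (s * σ ^ 2) := by gcongr
    have h2 : 3 * (n : ℝ) ≤ m * (1 / (256 * κ ^ 4)) := by
      rw [mul_one_div, le_div_iff₀ (by positivity)]
      linarith
    linarith
  have hsub : {ω | ¬ ∀ u : EuclideanSpace ℝ (Fin n),
      ∑ h, (∑ j, u j * β h ω j) ^ 2 ≤ 16 * σ ^ 2 * m * ‖u‖ ^ 2} ⊆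
      {ω | ∃ v ∈ N, s * (4 * σ ^ 2 * m) ≤ ∑ h, s * (∑ j, v j * β h ω j) ^ 2} := by
    intro ω hω
    by_contra hcon
    have hcon' : ∀ v ∈ N, ∑ h, s * (∑ j, v j * β h ω j) ^ 2 < s * (4 * σ ^ 2 * m) := by
      intro v hv
      by_contra hle
      exact hcon ⟨v, hv, not_lt.1 hle⟩
    refine hω fun u => ?_
    have h1 := sum_sq_map_le_of_net (fun h => codeForm (β h ω)) (A := 4 * σ ^ 2 * m) hNnet
      (fun v hv => by
        have h2 := hcon' v hv
        rw [← Finset.mul_sum] at h2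
        simp_rw [codeForm_apply]
        exact (lt_of_mul_lt_mul_left h2 hs0.le).le) u
    simp_rw [codeForm_apply] at h1
    linarith
  refine (measure_mono hsub).trans ((measure_exists_mem_le N _ hv).trans
    (ENNReal.ofReal_le_ofReal ?_))
  calc (N.card : ℝ) * Real.exp (-(6 * n)) ≤ Real.exp (n * 4) * Real.exp (-(6 * n)) := by
        gcongr
        refine hNcard.trans ?_
        rw [Real.exp_nat_mul]
        gcongr
        have := Real.add_one_le_exp 4
        linarith
    _ = Real.exp (-(2 * n)) := by rw [← Real.exp_add]; congr 1; ring

lemma measure_not_lower_le (hν : IsEntryLaw ν γ Γ σ) (hk2 : 2 ≤ k) (hk : k ≤ n) (hκ : 0 < κ)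
    (hΓκ : Γ ≤ κ * σ)
    (hind : iIndepFun β μ) (hlaw : ∀ h, HasLaw (β h) (codeLaw n k ν) μ)
    (hm : 139264 * κ ^ 4 * (n ^ 6 / k ^ 5) ≤ m) (i : Fin n) :
    μ {ω | (∀ u : EuclideanSpace ℝ (Fin n),
        ∑ h, (∑ j, u j * β h ω j) ^ 2 ≤ 16 * σ ^ 2 * m * ‖u‖ ^ 2) ∧
      ¬ ∀ u : EuclideanSpace ℝ (Fin n),
        m * (σ ^ 2 * (k * (k - 1) / (4 * n ^ 2))) * ‖u‖ ^ 2 ≤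
          ∑ h, if β h ω i ≠ 0 then (∑ j, u j * β h ω j) ^ 2 else 0} ≤
      ENNReal.ofReal (Real.exp (-(2 * n))) := by
  have hΓ := hν.Gamma_pos
  have hσ := hν.sigma_pos
  have hk0 : (0 : ℝ) < k := by exact_mod_cast (by omega : 0 < k)
  have hn0 : (0 : ℝ) < n := by exact_mod_cast (by omega : 0 < n)
  have hkR : (2 : ℝ) ≤ k := by exact_mod_cast hk2
  have hknR : (k : ℝ) ≤ n := by exact_mod_cast hk
  have hk1 : (k : ℝ) / 2 ≤ k - 1 := by linarith
  -- The net radius balances the two bounds: `16 σ² ε²` is at most an eighth of the mean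
  -- `σ² k (k - 1) / n²`.
  obtain ⟨N, hN1, hNnet, hNcard⟩ :=
    exists_net_unitSphere (E := EuclideanSpace ℝ (Fin n)) (ε := k / (16 * n)) (by positivity)
  rw [finrank_euclideanSpace_fin] at hNcard
  set s := σ ^ 2 / (256 * Γ ^ 4) with hs
  have hs0 : 0 < s := by positivity
  have hsκ := hν.one_div_le_scale hκ hΓκ
  rw [← hs] at hsκ
  set q : ℝ := k * (k - 1) / n ^ 2 with hq
  have hq1 : (k : ℝ) ^ 2 / (2 * n ^ 2) ≤ q := by
    rw [hq, div_le_div_iff₀ (by positivity) (by positivity)]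
    nlinarith [mul_le_mul_of_nonneg_left hk1 (by positivity : 0 ≤ 2 * (k : ℝ) * n ^ 2)]
  have hq0 : 0 < q := lt_of_lt_of_le (by positivity) hq1
  have hv : ∀ v ∈ N, μ {ω | -(3 / 4 * s * (σ ^ 2 * q) * m) ≤
      ∑ h, -(s * (if β h ω i ≠ 0 then (∑ j, v j * β h ω j) ^ 2 else 0))} ≤
      ENNReal.ofReal (Real.exp (-(34 * (n ^ 2 / k)))) := by
    intro v hv
    have hv1 : ∑ j, v j ^ 2 = 1 := by
      rw [← EuclideanSpace.real_norm_sq_eq, hN1 v hv]; norm_num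
    have hmeas : Measurable fun b : Fin n → ℝ => if b i ≠ 0 then (∑ j, v j * b j) ^ 2 else 0 := by
      refine Measurable.ite ?_ (by fun_prop) measurable_const
      exact (measurableSet_eq_fun (measurable_pi_apply i) measurable_const).compl
    refine (measure_sum_ge_le_of_lintegral_exp_le hind hlaw
      (g := fun b => -(s * (if b i ≠ 0 then (∑ j, v j * b j) ^ 2 else 0))) (by fun_prop)
      (lintegral_codeLaw_exp_neg_sq_le hν (by omega) hk i hv1) _).trans
      (ENNReal.ofReal_le_ofReal (Real.exp_le_exp.2 ?_))
    have h1 : 1 / (256 * κ ^ 4) * ((k : ℝ) ^ 2 / (2 * n ^ 2)) ≤ s * σ ^ 2 * q := by gcongr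
    have h2 : 139264 * κ ^ 4 * (n ^ 6 / k ^ 5) * (1 / (256 * κ ^ 4) * ((k : ℝ) ^ 2 / (2 * n ^ 2))) ≤
        m * (s * σ ^ 2 * q) := by gcongr
    have h3 : 139264 * κ ^ 4 * (n ^ 6 / k ^ 5) * (1 / (256 * κ ^ 4) * ((k : ℝ) ^ 2 / (2 * n ^ 2))) =
        272 * (n ^ 2 / k) * (n / k) ^ 2 := by
      field_simp
      norm_num
    have h4 : (n : ℝ) ^ 2 / k * 1 ≤ n ^ 2 / k * (n / k) ^ 2 := by
      gcongr
      exact one_le_pow₀ ((one_le_div hk0).2 hknR)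
    linarith
  have hsub : {ω | (∀ u : EuclideanSpace ℝ (Fin n),
        ∑ h, (∑ j, u j * β h ω j) ^ 2 ≤ 16 * σ ^ 2 * m * ‖u‖ ^ 2) ∧
      ¬ ∀ u : EuclideanSpace ℝ (Fin n),
        m * (σ ^ 2 * (k * (k - 1) / (4 * n ^ 2))) * ‖u‖ ^ 2 ≤
          ∑ h, if β h ω i ≠ 0 then (∑ j, u j * β h ω j) ^ 2 else 0} ⊆
      {ω | ∃ v ∈ N, -(3 / 4 * s * (σ ^ 2 * q) * m) ≤
        ∑ h, -(s * (if β h ω i ≠ 0 then (∑ j, v j * β h ω j) ^ 2 else 0))} := by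
    rintro ω ⟨hup, hω⟩
    by_contra hcon
    have hcon' : ∀ v ∈ N, ∑ h, -(s * (if β h ω i ≠ 0 then (∑ j, v j * β h ω j) ^ 2 else 0)) <
        -(3 / 4 * s * (σ ^ 2 * q) * m) := by
      intro v hv
      by_contra hle
      exact hcon ⟨v, hv, not_lt.1 hle⟩
    refine hω fun u => ?_
    set ℓ : Fin m → EuclideanSpace ℝ (Fin n) →L[ℝ] ℝ :=
      fun h => if β h ω i ≠ 0 then codeForm (β h ω) else 0 with hℓ
    have hℓsq : ∀ h (u : EuclideanSpace ℝ (Fin n)), (ℓ h u) ^ 2 =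
        if β h ω i ≠ 0 then (∑ j, u j * β h ω j) ^ 2 else 0 := by
      intro h u
      by_cases hz : β h ω i = 0 <;> simp [hℓ, hz, codeForm_apply]
    have h1 := le_sum_sq_map_of_net ℓ (A := 3 / 4 * (σ ^ 2 * q) * m) (B := 16 * σ ^ 2 * m)
      (by positivity)
      (fun u => by
        refine le_trans (Finset.sum_le_sum fun h _ => ?_) (hup u)
        rw [hℓsq]
        split_ifs
        · exact le_rfl
        · positivity) hNnet
      (fun v hv => by
        have h2 := hcon' v hv
        rw [Finset.sum_neg_distrib, ← Finset.mul_sum, neg_lt_neg_iff] at h2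
        simp_rw [hℓsq]
        have h3 : s * (3 / 4 * (σ ^ 2 * q) * m) <
            s * ∑ h, if β h ω i ≠ 0 then (∑ j, v j * β h ω j) ^ 2 else 0 := by linarith
        exact (lt_of_mul_lt_mul_left h3 hs0.le).le) u
    simp_rw [hℓsq] at h1
    refine le_trans ?_ h1
    refine mul_le_mul_of_nonneg_right ?_ (by positivity)
    have h5 : ((k : ℝ) / (16 * n)) ^ 2 ≤ q / 128 := by
      calc ((k : ℝ) / (16 * n)) ^ 2 = (k : ℝ) ^ 2 / (2 * n ^ 2) / 128 := by
            field_simp; norm_num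
        _ ≤ q / 128 := by gcongr
    have h6 : (k : ℝ) * (k - 1) / (4 * n ^ 2) = q / 4 := by
      rw [hq]; field_simp
    rw [h6]
    have h7 := mul_le_mul_of_nonneg_left h5 (by positivity : 0 ≤ 16 * σ ^ 2 * (m : ℝ))
    linarith
  refine (measure_mono hsub).trans ((measure_exists_mem_le N _ hv).trans
    (ENNReal.ofReal_le_ofReal ?_))
  calc (N.card : ℝ) * Real.exp (-(34 * (n ^ 2 / k)))
      ≤ Real.exp (n * (32 * (n / k))) * Real.exp (-(34 * (n ^ 2 / k))) := by
        gcongr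
        refine hNcard.trans ?_
        rw [Real.exp_nat_mul]
        have h8 : 2 / ((k : ℝ) / (16 * n)) = 32 * (n / k) := by field_simp; norm_num
        rw [h8, add_comm]
        gcongr
        exact Real.add_one_le_exp _
    _ = Real.exp (-(2 * (n ^ 2 / k))) := by rw [← Real.exp_add]; congr 1; ring
    _ ≤ Real.exp (-(2 * n)) := by
        rw [Real.exp_le_exp, neg_le_neg_iff]
        gcongr
        rw [le_div_iff₀ hk0, sq]
        gcongr

/-- Samples are well conditioned with overwhelming probability. -/
theorem measure_not_isWellConditioned_le (hν : IsEntryLaw ν γ Γ σ) (hk1 : 1 ≤ k) (hk : k ≤ n)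
    (hκ : 0 < κ) (hΓκ : Γ ≤ κ * σ)
    (hind : iIndepFun β μ) (hlaw : ∀ h, HasLaw (β h) (codeLaw n k ν) μ)
    (hm : 139264 * κ ^ 4 * (n ^ 6 / k ^ 5) ≤ m) :
    μ {ω | ¬ IsWellConditioned k γ Γ σ (fun h => β h ω)} ≤
      ENNReal.ofReal (Real.exp (-n)) := by
  have hk0 : (0 : ℝ) < k := by exact_mod_cast hk1
  have hknR : (k : ℝ) ≤ n := by exact_mod_cast hk
  have hn0 : (0 : ℝ) < n := hk0.trans_le hknR
  have hsupp : μ {ω | ¬ ∀ h, ∃ S : Finset (Fin n), S.card = k ∧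
      (∀ j ∈ S, γ ≤ |β h ω j| ∧ |β h ω j| ≤ Γ) ∧ ∀ j ∉ S, β h ω j = 0} = 0 := by
    rw [← ae_iff, ae_all_iff]
    intro h
    have h1 := ae_codeLaw (n := n) (k := k) hν
    rw [← (hlaw h).map_eq] at h1
    exact ae_of_ae_map (hlaw h).aemeasurable h1
  have hup := measure_not_upper_le (m := m) hν hk hκ hΓκ hind hlaw (by
    refine le_trans ?_ hm
    have h1 : (n : ℝ) ≤ n ^ 6 / k ^ 5 := by
      rw [le_div_iff₀ (by positivity)]
      calc (n : ℝ) * k ^ 5 ≤ n * n ^ 5 := by gcongr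
        _ = (n : ℝ) ^ 6 := by ring
    have h2 : 768 * κ ^ 4 * (n : ℝ) ≤ 768 * κ ^ 4 * (n ^ 6 / k ^ 5) := by gcongr
    have h3 : 0 ≤ κ ^ 4 * ((n : ℝ) ^ 6 / k ^ 5) := by positivity
    linarith)
  set U : Set Ω := {ω | ∀ u : EuclideanSpace ℝ (Fin n),
        ∑ h, (∑ j, u j * β h ω j) ^ 2 ≤ 16 * σ ^ 2 * m * ‖u‖ ^ 2} with hU
  set L : Fin n → Set Ω := fun i => {ω | ∀ u : EuclideanSpace ℝ (Fin n),
        m * (σ ^ 2 * (k * (k - 1) / (4 * n ^ 2))) * ‖u‖ ^ 2 ≤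
          ∑ h, if β h ω i ≠ 0 then (∑ j, u j * β h ω j) ^ 2 else 0} with hL
  have hlow : ∀ i ∈ (Finset.univ : Finset (Fin n)), μ {ω | ω ∈ U ∧ ω ∉ L i} ≤
      ENNReal.ofReal (Real.exp (-(2 * n))) := by
    intro i _
    rcases hk1.eq_or_lt with rfl | hk2
    · -- For `k = 1` the lower bound is zero.
      have : {ω | ω ∈ U ∧ ω ∉ L i} = ∅ := by
        ext ω
        simp only [Set.mem_ofPred_eq, Set.mem_empty_iff_false, iff_false, not_and, not_not]
        intro _ u
        simp only [Nat.cast_one, sub_self, mul_zero, zero_div, zero_mul]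
        refine Finset.sum_nonneg fun h _ => ?_
        split_ifs <;> positivity
      rw [this, measure_empty]
      exact zero_le
    · exact measure_not_lower_le hν hk2 hk hκ hΓκ hind hlaw hm i
  have hlow' := measure_exists_mem_le (Finset.univ : Finset (Fin n)) (fun i ω => ω ∈ U ∧ ω ∉ L i)
    hlow
  have hsub : {ω | ¬ IsWellConditioned k γ Γ σ (fun h => β h ω)} ⊆
      ({ω | ¬ ∀ h, ∃ S : Finset (Fin n), S.card = k ∧
        (∀ j ∈ S, γ ≤ |β h ω j| ∧ |β h ω j| ≤ Γ) ∧ ∀ j ∉ S, β h ω j = 0} ∪ {ω | ω ∉ U}) ∪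
        {ω | ∃ i ∈ (Finset.univ : Finset (Fin n)), ω ∈ U ∧ ω ∉ L i} := by
    intro ω hω
    by_contra hcon
    simp only [Set.mem_union, Set.mem_ofPred_eq, not_or, not_not, not_exists, not_and,
      Finset.mem_univ, true_and] at hcon
    exact hω ⟨hcon.1.1, hcon.1.2, fun i => hcon.2 i hcon.1.2⟩
  refine (measure_mono hsub).trans ((measure_union_le _ _).trans
    ((add_le_add_left (measure_union_le _ _) _).trans ?_))
  rw [hsupp, zero_add]
  refine (add_le_add hup hlow').trans ?_
  rw [← ENNReal.ofReal_add (Real.exp_pos _).le (by positivity)]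
  refine ENNReal.ofReal_le_ofReal ?_
  rw [Finset.card_univ, Fintype.card_fin]
  calc Real.exp (-(2 * n)) + n * Real.exp (-(2 * n)) = (n + 1) * Real.exp (-(2 * n)) := by ring
    _ ≤ Real.exp n * Real.exp (-(2 * n)) := by
        gcongr
        exact Real.add_one_le_exp _
    _ = Real.exp (-n) := by rw [← Real.exp_add]; congr 1; ring

end Concentration

/-! ### The norm `‖·‖_{1,2}` and the projection step -/

section MaxColNorm

variable {d n : ℕ}

lemma norm_col_le_maxColNorm (A : QueryMatrix d n) (i : Fin n) : ‖A i‖ ≤ maxColNorm A :=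
  le_ciSup (f := fun i => ‖A i‖) (Set.finite_range _).bddAbove i

lemma maxColNorm_le {A : QueryMatrix d n} {r : ℝ} (hn : 0 < n) (h : ∀ i, ‖A i‖ ≤ r) :
    maxColNorm A ≤ r := by
  have : Nonempty (Fin n) := ⟨⟨0, hn⟩⟩
  exact ciSup_le h

/-- The projection onto `{E | ‖E‖_{1,2} ≤ ρ}` acts on each column as the projection onto a
ball, hence brings each column closer to the columns of any matrix of the constraint set. -/
lemma norm_col_sub_le_of_isMinOn {ρ : ℝ} {Y E W : QueryMatrix d n} (hn : 0 < n)
    (hE : maxColNorm E ≤ ρ) (hmin : IsMinOn (fun F => ‖F - Y‖) {F | maxColNorm F ≤ ρ} E)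
    (hW : maxColNorm W ≤ ρ) (i : Fin n) : ‖E i - W i‖ ≤ ‖Y i - W i‖ := by
  classical
  have hEi : E i ∈ Metric.closedBall (0 : EuclideanSpace ℝ (Fin d)) ρ :=
    mem_closedBall_zero_iff.2 ((norm_col_le_maxColNorm E i).trans hE)
  have hWi : W i ∈ Metric.closedBall (0 : EuclideanSpace ℝ (Fin d)) ρ :=
    mem_closedBall_zero_iff.2 ((norm_col_le_maxColNorm W i).trans hW)
  have hcol : ∀ v ∈ Metric.closedBall (0 : EuclideanSpace ℝ (Fin d)) ρ, ‖Y i - E i‖ ≤ ‖Y i - v‖ := by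
    intro v hv
    -- Compare with the matrix in which column `i` is replaced by `v`.
    set F : QueryMatrix d n := WithLp.toLp 2 (Function.update (fun j => E j) i v) with hF
    have hFi : F i = v := by simp [hF]
    have hFj : ∀ j, j ≠ i → F j = E j := fun j hj => by simp [hF, hj]
    have hFmem : maxColNorm F ≤ ρ := by
      refine maxColNorm_le hn fun j => ?_
      by_cases hj : j = i
      · rw [hj, hFi]; exact mem_closedBall_zero_iff.1 hv
      · rw [hFj j hj]; exact (norm_col_le_maxColNorm E j).trans hE
    have h1 : ‖E - Y‖ ^ 2 ≤ ‖F - Y‖ ^ 2 := by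
      have : ‖E - Y‖ ≤ ‖F - Y‖ := hmin hFmem
      gcongr
    rw [PiLp.norm_sq_eq_of_L2, PiLp.norm_sq_eq_of_L2,
      ← Finset.add_sum_erase _ _ (Finset.mem_univ i),
      ← Finset.add_sum_erase _ (fun j => ‖(F - Y) j‖ ^ 2) (Finset.mem_univ i)] at h1
    have h2 : ∑ j ∈ Finset.univ.erase i, ‖(F - Y) j‖ ^ 2 =
        ∑ j ∈ Finset.univ.erase i, ‖(E - Y) j‖ ^ 2 := by
      refine Finset.sum_congr rfl fun j hj => ?_
      rw [PiLp.sub_apply, PiLp.sub_apply, hFj j (Finset.ne_of_mem_erase hj)]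
    rw [h2, add_le_add_iff_right, PiLp.sub_apply, PiLp.sub_apply, hFi] at h1
    rw [norm_sub_rev, norm_sub_rev (Y i) v]
    exact le_of_sq_le_sq h1 (norm_nonneg _)
  have hinf : ‖Y i - E i‖ = ⨅ w : Metric.closedBall (0 : EuclideanSpace ℝ (Fin d)) ρ,
      ‖Y i - w‖ := by
    have : Nonempty (Metric.closedBall (0 : EuclideanSpace ℝ (Fin d)) ρ) := ⟨⟨_, hEi⟩⟩
    refine le_antisymm (le_ciInf fun w => hcol w w.2) ?_
    exact ciInf_le ⟨0, by rintro _ ⟨w, rfl⟩; exact norm_nonneg _⟩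
      (⟨E i, hEi⟩ : Metric.closedBall (0 : EuclideanSpace ℝ (Fin d)) ρ)
  have hinner := (norm_eq_iInf_iff_real_inner_le_zero (convex_closedBall _ _) hEi).1 hinf _ hWi
  have hsq : ‖Y i - W i‖ ^ 2 = ‖Y i - E i‖ ^ 2 - 2 * ⟪Y i - E i, W i - E i⟫_ℝ +
      ‖E i - W i‖ ^ 2 := by
    rw [← norm_sub_rev (W i) (E i), ← norm_sub_sq_real]
    congr 2
    abel
  refine le_of_sq_le_sq ?_ (norm_nonneg _)
  nlinarith [sq_nonneg ‖Y i - E i‖]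

end MaxColNorm

/-! ### Selection of the support -/

/-- If every entry of `f` on `T` has absolute value above `r`, every other one below `r`, then
`T` is the only maximizer of `∑_{i ∈ S} |f i|` among the sets with at most `#T` elements. -/
lemma eq_of_forall_sum_abs_le {ι : Type*} [DecidableEq ι] {f : ι → ℝ} {r : ℝ} {S T : Finset ι}
    (hr : 0 ≤ r) (hT : ∀ i ∈ T, r < |f i|) (hT' : ∀ i ∉ T, |f i| < r) (hcard : S.card ≤ T.card)
    (hS : ∑ i ∈ T, |f i| ≤ ∑ i ∈ S, |f i|) : S = T := by
  have h1 : (S \ T).card ≤ (T \ S).card := by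
    have a := Finset.card_sdiff_add_card_inter S T
    have b := Finset.card_sdiff_add_card_inter T S
    rw [Finset.inter_comm] at b
    omega
  have h2 : ∑ i ∈ T \ S, |f i| ≤ ∑ i ∈ S \ T, |f i| := by
    have a := Finset.sum_inter_add_sum_sdiff S T (fun i => |f i|)
    have b := Finset.sum_inter_add_sum_sdiff T S (fun i => |f i|)
    rw [Finset.inter_comm] at b
    linarith
  have h3 : T ⊆ S := by
    rw [← Finset.sdiff_eq_empty_iff_subset]
    by_contra hne
    have hne' := Finset.nonempty_iff_ne_empty.2 hne
    have h4 : ((T \ S).card : ℝ) * r < ∑ i ∈ T \ S, |f i| := by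
      rw [← nsmul_eq_mul, ← Finset.sum_const]
      exact Finset.sum_lt_sum_of_nonempty hne' fun i hi => hT i (Finset.mem_sdiff.1 hi).1
    have h5 : ∑ i ∈ S \ T, |f i| ≤ ((S \ T).card : ℝ) * r := by
      rw [← nsmul_eq_mul, ← Finset.sum_const]
      exact Finset.sum_le_sum fun i hi => (hT' i (Finset.mem_sdiff.1 hi).2).le
    have h6 : ((S \ T).card : ℝ) * r ≤ ((T \ S).card : ℝ) * r := by
      gcongr
    linarith
  exact (Finset.eq_of_subset_of_card_le h3 hcard).symm

/-! ### The loss near the true concepts -/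

section Loss

variable {d n m k : ℕ} {γ Γ σ : ℝ} {Dstar : QueryMatrix d n} {b : Fin m → Fin n → ℝ}
  {sel : QueryMatrix d n → EuclideanSpace ℝ (Fin d) → Finset (Fin n)}

lemma ColumnOrthogonal.inner_mulVec (hD : ColumnOrthogonal Dstar) (c : Fin n → ℝ) (i : Fin n) :
    ⟪Dstar i, Dstar.mulVec c⟫_ℝ = c i :=
  hD.inner_right_fintype c i

lemma ColumnOrthogonal.norm_mulVec_sq (hD : ColumnOrthogonal Dstar) (c : Fin n → ℝ) :
    ‖Dstar.mulVec c‖ ^ 2 = ∑ i, c i ^ 2 := by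
  rw [← real_inner_self_eq_norm_sq]
  have := hD.inner_sum c c Finset.univ
  simp only [conj_trivial] at this
  rw [QueryMatrix.mulVec, this]
  exact Finset.sum_congr rfl fun i _ => (sq _).symm

lemma integral_inner_sq_stdGaussian (v : EuclideanSpace ℝ (Fin d)) :
    ∫ z, ⟪v, z⟫_ℝ ^ 2 ∂(stdGaussian (EuclideanSpace ℝ (Fin d))) = ‖v‖ ^ 2 := by
  have h1 := variance_dual_stdGaussian (innerSL ℝ v)
  rw [variance_of_integral_eq_zero (innerSL ℝ v).continuous.aemeasurable
    (integral_strongDual_stdGaussian _), innerSL_apply_norm] at h1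
  simpa using h1

lemma IsWellConditioned.norm_mulVec_le (hb : IsWellConditioned k γ Γ σ b) (hΓ : 0 < Γ)
    (hD : ColumnOrthogonal Dstar) (h : Fin m) : ‖Dstar.mulVec (b h)‖ ≤ Real.sqrt k * Γ := by
  obtain ⟨S, hS, hin, hout⟩ := hb.support h
  refine le_of_sq_le_sq ?_ (by positivity)
  rw [hD.norm_mulVec_sq, mul_pow, Real.sq_sqrt (by positivity), ← hS, ← nsmul_eq_mul,
    ← Finset.sum_const, ← Finset.sum_subset (Finset.subset_univ S)
      (fun j _ hj => by rw [hout j hj]; ring)]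
  refine Finset.sum_le_sum fun j hj => ?_
  rw [← sq_abs]
  have := (hin j hj).2
  gcongr

/-- Close to the true concepts the estimator selects exactly the support of the code. -/
lemma IsWellConditioned.sel_eq (hb : IsWellConditioned k γ Γ σ b) (hγ : 0 < γ) (hΓ : 0 < Γ)
    (hD : ColumnOrthogonal Dstar) (hsel : IsSelectionRule k sel) {F : QueryMatrix d n}
    (hF : ∀ i, ‖F i - Dstar i‖ * (Real.sqrt k * Γ) < γ / 2) (h : Fin m) :
    sel F (Dstar.mulVec (b h)) = Finset.univ.filter (fun i => b h i ≠ 0) := by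
  obtain ⟨S, hS, hin, hout⟩ := hb.support h
  have hSeq : Finset.univ.filter (fun i => b h i ≠ 0) = S := by
    ext i
    simp only [Finset.mem_filter, Finset.mem_univ, true_and]
    refine ⟨fun hi => by_contra fun hiS => hi (hout i hiS), fun hi => ?_⟩
    exact abs_pos.1 (hγ.trans_le (hin i hi).1)
  rw [hSeq]
  set x := Dstar.mulVec (b h) with hx
  obtain ⟨hcard, hmax⟩ := hsel F x
  have hclose : ∀ i, |⟪F i, x⟫_ℝ - b h i| < γ / 2 := by
    intro i
    rw [← hD.inner_mulVec (b h) i, ← hx, ← inner_sub_left]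
    refine (abs_real_inner_le_norm _ _).trans_lt (lt_of_le_of_lt ?_ (hF i))
    gcongr
    exact hb.norm_mulVec_le hΓ hD h
  refine eq_of_forall_sum_abs_le (f := fun i => ⟪F i, x⟫_ℝ) (r := γ / 2) (by positivity)
    (fun i hi => ?_) (fun i hi => ?_) (hcard.trans hS.ge) (hmax S hS.le)
  · have h1 := abs_sub_abs_le_abs_sub (b h i) ⟪F i, x⟫_ℝ
    rw [abs_sub_comm] at h1
    linarith [hclose i, (hin i hi).1]
  · have := hclose i
    rwa [hout i hi, sub_zero] at this

/-- The quadratic function with which the loss agrees near the true concepts. -/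
noncomputable def localLoss (Dstar : QueryMatrix d n) (b : Fin m → Fin n → ℝ)
    (F : QueryMatrix d n) : ℝ :=
  (1 / (m : ℝ)) * ∑ h, ∑ i, if b h i ≠ 0 then ⟪F i - Dstar i, Dstar.mulVec (b h)⟫_ℝ ^ 2 else 0

lemma IsWellConditioned.aggLoss_eq (hb : IsWellConditioned k γ Γ σ b) (hγ : 0 < γ) (hΓ : 0 < Γ)
    (hD : ColumnOrthogonal Dstar) (hsel : IsSelectionRule k sel) {F : QueryMatrix d n}
    (hF : ∀ i, ‖F i - Dstar i‖ * (Real.sqrt k * Γ) < γ / 2) :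
    aggLoss Dstar sel (fun h => Dstar.mulVec (b h)) F = localLoss Dstar b F := by
  rw [aggLoss, localLoss]
  congr 1
  refine Finset.sum_congr rfl fun h _ => ?_
  set x := Dstar.mulVec (b h) with hx
  have hxi : ∀ i, ⟪Dstar i, x⟫_ℝ = b h i := fun i => hD.inner_mulVec (b h) i
  set c : Fin n → ℝ := fun i => if b h i ≠ 0 then ⟪F i - Dstar i, x⟫_ℝ else 0 with hc
  have hz : ∀ z : EuclideanSpace ℝ (Fin d),
      ⟪x, z⟫_ℝ - surrogate sel F x (fun i => ⟪Dstar i, z⟫_ℝ) = -⟪Dstar.mulVec c, z⟫_ℝ := by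
    intro z
    have h1 : ⟪x, z⟫_ℝ = ∑ i, b h i * ⟪Dstar i, z⟫_ℝ := by
      rw [hx, QueryMatrix.mulVec, sum_inner]
      exact Finset.sum_congr rfl fun i _ => real_inner_smul_left _ _ _
    have h2 : ⟪Dstar.mulVec c, z⟫_ℝ = ∑ i, c i * ⟪Dstar i, z⟫_ℝ := by
      rw [QueryMatrix.mulVec, sum_inner]
      exact Finset.sum_congr rfl fun i _ => real_inner_smul_left _ _ _
    rw [h1, h2, surrogate, hb.sel_eq hγ hΓ hD hsel hF h, Finset.sum_filter,
      ← Finset.sum_sub_distrib, ← Finset.sum_neg_distrib]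
    refine Finset.sum_congr rfl fun i _ => ?_
    by_cases hi : b h i = 0
    · simp [hc, hi]
    · simp only [hc, ne_eq, hi, not_false_eq_true, if_true]
      rw [inner_sub_left, hxi i]
      ring
  simp_rw [hz, neg_sq]
  rw [integral_inner_sq_stdGaussian, hD.norm_mulVec_sq]
  refine Finset.sum_congr rfl fun i _ => ?_
  by_cases hi : b h i = 0 <;> simp [hc, hi]

/-- The gradient of `localLoss`, column by column. -/
noncomputable def localGrad (Dstar : QueryMatrix d n) (b : Fin m → Fin n → ℝ)
    (F : QueryMatrix d n) : QueryMatrix d n :=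
  WithLp.toLp 2 fun i => (2 / (m : ℝ)) • ∑ h,
    if b h i ≠ 0 then ⟪F i - Dstar i, Dstar.mulVec (b h)⟫_ℝ • Dstar.mulVec (b h) else 0

lemma hasGradientAt_localLoss (D Δ : QueryMatrix d n) :
    HasGradientAt (fun F => localLoss Dstar b (D + F)) (localGrad Dstar b (D + Δ)) Δ := by
  rw [hasGradientAt_iff_hasFDerivAt]
  have hterm : ∀ (h : Fin m) (i : Fin n), HasFDerivAt
      (fun F : QueryMatrix d n => if b h i ≠ 0 then
        ⟪(D + F) i - Dstar i, Dstar.mulVec (b h)⟫_ℝ ^ 2 else 0)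
      (if b h i ≠ 0 then (2 * ⟪(D + Δ) i - Dstar i, Dstar.mulVec (b h)⟫_ℝ) •
        ((innerSL ℝ (Dstar.mulVec (b h))).comp (PiLp.proj 2 (𝕜 := ℝ)
          (fun _ : Fin n => EuclideanSpace ℝ (Fin d)) i)) else 0) Δ := by
    intro h i
    by_cases hi : b h i = 0
    · simp only [hi, ne_eq, not_true_eq_false, if_false]
      exact hasFDerivAt_const _ _
    · simp only [hi, ne_eq, not_false_eq_true, if_true]
      set x := Dstar.mulVec (b h)
      set ℓ := (innerSL ℝ x).comp (PiLp.proj 2 (𝕜 := ℝ)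
          (fun _ : Fin n => EuclideanSpace ℝ (Fin d)) i) with hℓ
      have h1 : HasFDerivAt (fun F : QueryMatrix d n => ⟪(D + F) i - Dstar i, x⟫_ℝ) ℓ Δ := by
        have h2 : (fun F : QueryMatrix d n => ⟪(D + F) i - Dstar i, x⟫_ℝ) =
            fun F => ℓ F + ⟪D i - Dstar i, x⟫_ℝ := by
          ext F
          have h3 : ℓ F = ⟪x, F i⟫_ℝ := rfl
          rw [h3, real_inner_comm (F i) x, ← inner_add_left, PiLp.add_apply]
          congr 1
          abel
        rw [h2]
        exact ℓ.hasFDerivAt.add_const _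
      refine (h1.pow 2).congr_fderiv ?_
      ext H
      simp
  have hsum := ((HasFDerivAt.fun_sum (u := Finset.univ) fun h _ =>
    HasFDerivAt.fun_sum (u := Finset.univ) fun i _ => hterm h i).const_mul (1 / (m : ℝ)))
  refine hsum.congr_fderiv ?_
  ext H
  have hl : ∀ (h : Fin m) (i : Fin n), (if b h i ≠ 0 then
        (2 * ⟪(D + Δ) i - Dstar i, Dstar.mulVec (b h)⟫_ℝ) •
        ((innerSL ℝ (Dstar.mulVec (b h))).comp (PiLp.proj 2 (𝕜 := ℝ)
          (fun _ : Fin n => EuclideanSpace ℝ (Fin d)) i)) else 0) H =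
      2 * ⟪if b h i ≠ 0 then ⟪(D + Δ) i - Dstar i, Dstar.mulVec (b h)⟫_ℝ • Dstar.mulVec (b h)
        else 0, H i⟫_ℝ := by
    intro h i
    split_ifs
    · rw [real_inner_smul_left, ← mul_assoc]
      rfl
    · simp
  have hr : ∀ i, ⟪localGrad Dstar b (D + Δ) i, H i⟫_ℝ = (2 / (m : ℝ)) * ∑ h,
      ⟪if b h i ≠ 0 then ⟪(D + Δ) i - Dstar i, Dstar.mulVec (b h)⟫_ℝ • Dstar.mulVec (b h)
        else 0, H i⟫_ℝ := by
    intro i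
    rw [← sum_inner, ← real_inner_smul_left]
    rfl
  rw [InnerProductSpace.toDual_apply_apply, PiLp.inner_apply, Finset.sum_congr rfl fun i _ => hr i,
    smul_apply, sum_apply]
  simp_rw [sum_apply, hl, ← Finset.mul_sum]
  rw [Finset.sum_comm, smul_eq_mul]
  ring

end Loss

/-! ### Contraction of the gradient step -/

/-- A gradient step for the quadratic form `(1/m) ∑ ⟪e, y h⟫²`, whose matrix is at most `B` and
is at least `A` in the direction of `e`. By Cauchy–Schwarz the squared norm of the gradient is at
most `4 B` times the value of the form, so that for `η B ≤ 1/2` the second-order term of the step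
is at most half of the first-order gain. -/
lemma norm_sub_gradient_sq_le {E : Type*} [NormedAddCommGroup E] [InnerProductSpace ℝ E] {m : ℕ}
    (hm : 0 < m) (y : Fin m → E) {A B η : ℝ} (hη : 0 < η) (hηB : η * B ≤ 1 / 2)
    (hB : ∀ u, ∑ h, ⟪u, y h⟫_ℝ ^ 2 ≤ B * m * ‖u‖ ^ 2) (e : E)
    (hA : m * A * ‖e‖ ^ 2 ≤ ∑ h, ⟪e, y h⟫_ℝ ^ 2) :
    ‖e - η • ((2 / (m : ℝ)) • ∑ h, ⟪e, y h⟫_ℝ • y h)‖ ^ 2 ≤ (1 - 2 * A * η) * ‖e‖ ^ 2 := by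
  have hm0 : (0 : ℝ) < m := by exact_mod_cast hm
  set w := ∑ h, ⟪e, y h⟫_ℝ • y h with hw
  set q := ∑ h, ⟪e, y h⟫_ℝ ^ 2 with hq
  have hq0 : 0 ≤ q := by positivity
  have hew : ⟪e, w⟫_ℝ = q := by
    rw [hw, hq, inner_sum]
    refine Finset.sum_congr rfl fun h _ => ?_
    rw [real_inner_smul_right, sq]
  have hww : ‖w‖ ^ 2 = ∑ h, ⟪e, y h⟫_ℝ * ⟪w, y h⟫_ℝ := by
    rw [← real_inner_self_eq_norm_sq]
    conv_lhs => rw [hw, inner_sum]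
    refine Finset.sum_congr rfl fun h _ => ?_
    rw [real_inner_smul_right]
  have hwB : ‖w‖ ^ 2 * ‖w‖ ^ 2 ≤ q * (B * m) * ‖w‖ ^ 2 := by
    calc ‖w‖ ^ 2 * ‖w‖ ^ 2 = (∑ h, ⟪e, y h⟫_ℝ * ⟪w, y h⟫_ℝ) ^ 2 := by rw [← hww]; ring
      _ ≤ q * ∑ h, ⟪w, y h⟫_ℝ ^ 2 := Finset.sum_mul_sq_le_sq_mul_sq _ _ _
      _ ≤ q * (B * m * ‖w‖ ^ 2) := by gcongr; exact hB w
      _ = _ := by ring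
  have hwle : ‖w‖ ^ 2 ≤ q * (B * m) ∨ w = 0 := by
    rcases eq_or_ne w 0 with h0 | h0
    · exact Or.inr h0
    · have : 0 < ‖w‖ ^ 2 := by
        have := norm_pos_iff.2 h0
        positivity
      exact Or.inl (le_of_mul_le_mul_right hwB this)
  have ht : 0 < η * (2 / (m : ℝ)) := by positivity
  set t := η * (2 / (m : ℝ)) with htdef
  have htw : t ^ 2 * ‖w‖ ^ 2 ≤ t * q := by
    rcases hwle with h | h
    · calc t ^ 2 * ‖w‖ ^ 2 ≤ t ^ 2 * (q * (B * m)) := by gcongr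
        _ = t * q * (2 * (η * B)) := by rw [htdef]; field_simp
        _ ≤ t * q * 1 := by gcongr; linarith
        _ = t * q := mul_one _
    · rw [h]
      simp only [norm_zero, ne_eq, OfNat.ofNat_ne_zero, not_false_eq_true, zero_pow, mul_zero]
      positivity
  rw [smul_smul, ← htdef, norm_sub_sq_real, real_inner_smul_right, hew, norm_smul, mul_pow,
    Real.norm_eq_abs, sq_abs]
  have h1 : t * (m * A * ‖e‖ ^ 2) ≤ t * q := by gcongr
  have h2 : t * (m * A * ‖e‖ ^ 2) = 2 * A * η * ‖e‖ ^ 2 := by rw [htdef]; field_simp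
  linarith

section Step

variable {d n m k : ℕ} {γ Γ σ η ρ : ℝ} {D Dstar : QueryMatrix d n} {b : Fin m → Fin n → ℝ}
  {sel : QueryMatrix d n → EuclideanSpace ℝ (Fin d) → Finset (Fin n)}

/-- Parseval: the columns of a column-orthogonal full-rank matrix form an orthonormal basis, and
`v` is the coordinate vector of `u` in it. -/
lemma ColumnOrthogonal.exists_coordinates (hD : ColumnOrthogonal Dstar) (hR : FullRank Dstar)
    (u : EuclideanSpace ℝ (Fin d)) : ∃ v : EuclideanSpace ℝ (Fin n), ‖v‖ = ‖u‖ ∧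
      ∀ c : Fin n → ℝ, ⟪u, Dstar.mulVec c⟫_ℝ = ∑ j, v j * c j := by
  obtain ⟨B, hB⟩ : ∃ B : OrthonormalBasis (Fin n) ℝ (EuclideanSpace ℝ (Fin d)),
      ∀ j, B j = Dstar j :=
    ⟨OrthonormalBasis.mk hD (le_of_eq hR.symm), fun j =>
      congrFun (OrthonormalBasis.coe_mk hD (le_of_eq hR.symm)) j⟩
  refine ⟨B.repr u, B.repr.norm_map u, fun c => ?_⟩
  rw [QueryMatrix.mulVec, inner_sum]
  refine Finset.sum_congr rfl fun j _ => ?_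
  rw [real_inner_smul_right, B.repr_apply_apply, real_inner_comm, hB, mul_comm]

lemma IsWellConditioned.norm_col_step_sq_le (hb : IsWellConditioned k γ Γ σ b) (hσ : 0 < σ)
    (hD : ColumnOrthogonal Dstar) (hR : FullRank Dstar) (hm : 0 < m) (hη : 0 < η)
    (hησ : η ≤ 1 / 32 / σ ^ 2) (F : QueryMatrix d n) (i : Fin n) :
    ‖F i - Dstar i - η • localGrad Dstar b F i‖ ^ 2 ≤
      (1 - k * (k - 1) * σ ^ 2 / (2 * n ^ 2) * η) * ‖F i - Dstar i‖ ^ 2 := by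
  set y : Fin m → EuclideanSpace ℝ (Fin d) :=
    fun h => if b h i ≠ 0 then Dstar.mulVec (b h) else 0 with hy
  have hgrad : localGrad Dstar b F i =
      (2 / (m : ℝ)) • ∑ h, ⟪F i - Dstar i, y h⟫_ℝ • y h := by
    change (2 / (m : ℝ)) • _ = _
    congr 1
    refine Finset.sum_congr rfl fun h _ => ?_
    by_cases hi : b h i = 0 <;> simp [hy, hi]
  have hysq : ∀ (u : EuclideanSpace ℝ (Fin d)) (h : Fin m), ⟪u, y h⟫_ℝ ^ 2 =
      if b h i ≠ 0 then ⟪u, Dstar.mulVec (b h)⟫_ℝ ^ 2 else 0 := by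
    intro u h
    by_cases hi : b h i = 0 <;> simp [hy, hi]
  have hηB : η * (16 * σ ^ 2) ≤ 1 / 2 := by
    rw [le_div_iff₀ (by positivity)] at hησ
    linarith
  have h := norm_sub_gradient_sq_le hm y (A := σ ^ 2 * (k * (k - 1) / (4 * n ^ 2))) hη hηB
    (fun u => by
      obtain ⟨v, hv, hvu⟩ := hD.exists_coordinates hR u
      rw [← hv]
      refine le_trans (Finset.sum_le_sum fun h _ => ?_) (hb.upper v)
      rw [hysq, hvu]
      split_ifs
      · exact le_rfl
      · positivity) (F i - Dstar i)
    (by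
      obtain ⟨v, hv, hvu⟩ := hD.exists_coordinates hR (F i - Dstar i)
      rw [← hv]
      refine (hb.lower i v).trans_eq (Finset.sum_congr rfl fun h _ => ?_)
      rw [hysq, hvu])
  rw [hgrad]
  refine h.trans_eq ?_
  congr 2
  have hn : (n : ℝ) ≠ 0 := by
    have := i.pos
    positivity
  field_simp
  ring

lemma localLoss_le (hn : 0 < n) (hb : IsWellConditioned k γ Γ σ b)
    (F : QueryMatrix d n) :
    localLoss Dstar b F ≤ k * (∑ h, ‖Dstar.mulVec (b h)‖ ^ 2) / m *
      maxColNorm (F - Dstar) ^ 2 := by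
  have hM : 0 ≤ maxColNorm (F - Dstar) :=
    (norm_nonneg _).trans (norm_col_le_maxColNorm (F - Dstar) ⟨0, hn⟩)
  have hterm : ∀ h, ∑ i, (if b h i ≠ 0 then
      ⟪F i - Dstar i, Dstar.mulVec (b h)⟫_ℝ ^ 2 else 0) ≤
      k * (‖Dstar.mulVec (b h)‖ ^ 2 * maxColNorm (F - Dstar) ^ 2) := by
    intro h
    obtain ⟨S, hS, hin, hout⟩ := hb.support h
    rw [← Finset.sum_subset (Finset.subset_univ S)
      (fun j _ hj => by rw [hout j hj]; simp), ← hS, ← nsmul_eq_mul, ← Finset.sum_const]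
    refine Finset.sum_le_sum fun i _ => ?_
    split_ifs
    · rw [← sq_abs, ← mul_pow]
      have h1 := abs_real_inner_le_norm (F i - Dstar i) (Dstar.mulVec (b h))
      have h2 : ‖F i - Dstar i‖ ≤ maxColNorm (F - Dstar) := norm_col_le_maxColNorm (F - Dstar) i
      have h3 : |⟪F i - Dstar i, Dstar.mulVec (b h)⟫_ℝ| ≤
          ‖Dstar.mulVec (b h)‖ * maxColNorm (F - Dstar) := by
        rw [mul_comm]
        exact h1.trans (by gcongr)
      gcongr
    · positivity
  calc localLoss Dstar b F
      ≤ 1 / (m : ℝ) * ∑ h, k * (‖Dstar.mulVec (b h)‖ ^ 2 * maxColNorm (F - Dstar) ^ 2) := by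
        rw [localLoss]
        gcongr with h _
        exact hterm h
    _ = _ := by
        rw [← Finset.mul_sum, ← Finset.sum_mul]
        ring

/-- On a well-conditioned sample every run of constrained concept refinement stays in the region
where the loss is the quadratic `localLoss`, and contracts. -/
theorem IsWellConditioned.ccr (hb : IsWellConditioned k γ Γ σ b) (hγ : 0 < γ) (hΓ : 0 < Γ)
    (hσ : 0 < σ) (hk : 1 ≤ k) (hn : 0 < n) (hm : 0 < m)
    (hD : ColumnOrthogonal Dstar) (hR : FullRank Dstar) (hρ : maxColNorm (D - Dstar) = ρ)
    (hρle : ρ ≤ γ / (8 * Real.sqrt k * Γ)) (hη : 0 < η) (hησ : η ≤ 1 / 32 / σ ^ 2)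
    (hsel : IsSelectionRule k sel) {Δ : ℕ → QueryMatrix d n}
    (hΔ : IsCCRRun (aggLoss Dstar sel (fun h => Dstar.mulVec (b h))) D ρ η Δ) (t : ℕ) :
    DifferentiableAt ℝ
      (fun F => aggLoss Dstar sel (fun h => Dstar.mulVec (b h)) (D + F)) (Δ t) ∧
    maxColNorm (D + Δ (t + 1) - Dstar) ≤
      Real.sqrt (1 - (k : ℝ) * ((k : ℝ) - 1) * σ ^ 2 / (2 * (n : ℝ) ^ 2) * η) *
        maxColNorm (D + Δ t - Dstar) ∧
    aggLoss Dstar sel (fun h => Dstar.mulVec (b h)) (D + Δ t) ≤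
      (k : ℝ) * (∑ h, ‖Dstar.mulVec (b h)‖ ^ 2) / (m : ℝ) *
        maxColNorm (D + Δ t - Dstar) ^ 2 := by
  have hk0 : (0 : ℝ) < k := by exact_mod_cast hk
  have hρ0 : 0 ≤ ρ := hρ ▸ (norm_nonneg _).trans (norm_col_le_maxColNorm (D - Dstar) ⟨0, hn⟩)
  have hΔρ : ∀ i, ‖Δ t i‖ ≤ ρ := by
    intro i
    rcases t with _ | t
    · rw [hΔ.1, PiLp.zero_apply, norm_zero]; exact hρ0
    · exact (norm_col_le_maxColNorm _ i).trans (hΔ.2 t).1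
  have hclose : ∀ i, ‖(D + Δ t) i - Dstar i‖ * (Real.sqrt k * Γ) < γ / 2 := by
    intro i
    have h1 : ‖(D + Δ t) i - Dstar i‖ ≤ 2 * ρ := by
      have h2 : (D + Δ t) i - Dstar i = (D - Dstar) i + Δ t i := by
        rw [PiLp.add_apply, PiLp.sub_apply]; abel
      rw [h2]
      linarith [norm_add_le ((D - Dstar) i) (Δ t i), norm_col_le_maxColNorm (D - Dstar) i, hΔρ i]
    rw [le_div_iff₀ (by positivity)] at hρle
    calc ‖(D + Δ t) i - Dstar i‖ * (Real.sqrt k * Γ) ≤ 2 * ρ * (Real.sqrt k * Γ) := by gcongr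
      _ ≤ γ / 4 := by linarith
      _ < γ / 2 := by linarith
  have hgrad : HasGradientAt
      (fun F => aggLoss Dstar sel (fun h => Dstar.mulVec (b h)) (D + F))
      (localGrad Dstar b (D + Δ t)) (Δ t) := by
    refine (hasGradientAt_localLoss D (Δ t)).congr_of_eventuallyEq ?_
    have hev : ∀ᶠ F in nhds (Δ t), ∀ i, ‖(D + F) i - Dstar i‖ * (Real.sqrt k * Γ) < γ / 2 := by
      rw [eventually_all]
      intro i
      have hcont : Continuous fun F : QueryMatrix d n =>
          ‖(D + F) i - Dstar i‖ * (Real.sqrt k * Γ) := by fun_prop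
      exact (hcont.tendsto (Δ t)).eventually_lt_const (hclose i)
    filter_upwards [hev] with F hF
    exact hb.aggLoss_eq hγ hΓ hD hsel hF
  refine ⟨hgrad.differentiableAt, ?_, ?_⟩
  · have hmin := (hΔ.2 t).2
    rw [hgrad.gradient] at hmin
    refine maxColNorm_le hn fun i => ?_
    have hM : 0 ≤ maxColNorm (D + Δ t - Dstar) :=
      (norm_nonneg _).trans (norm_col_le_maxColNorm _ i)
    have hW : maxColNorm (Dstar - D) ≤ ρ := by
      refine maxColNorm_le hn fun j => ?_
      rw [← hρ, PiLp.sub_apply, norm_sub_rev, ← PiLp.sub_apply]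
      exact norm_col_le_maxColNorm _ j
    have h1 := norm_col_sub_le_of_isMinOn hn (hΔ.2 t).1 hmin hW i
    have h2 := hb.norm_col_step_sq_le hσ hD hR hm hη hησ (D + Δ t) i
    set τ := 1 - (k : ℝ) * ((k : ℝ) - 1) * σ ^ 2 / (2 * (n : ℝ) ^ 2) * η with hτ
    have e1 : (D + Δ (t + 1) - Dstar) i = Δ (t + 1) i - (Dstar - D) i := by
      simp only [PiLp.sub_apply, PiLp.add_apply]; abel
    have e2 : (Δ t - η • localGrad Dstar b (D + Δ t)) i - (Dstar - D) i =
        (D + Δ t) i - Dstar i - η • localGrad Dstar b (D + Δ t) i := by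
      simp only [PiLp.sub_apply, PiLp.add_apply, PiLp.smul_apply]; abel
    rw [e2] at h1
    rw [e1]
    calc ‖Δ (t + 1) i - (Dstar - D) i‖
        ≤ Real.sqrt (τ * ‖(D + Δ t) i - Dstar i‖ ^ 2) := h1.trans (Real.le_sqrt_of_sq_le h2)
      _ = Real.sqrt τ * ‖(D + Δ t) i - Dstar i‖ := by
          rw [Real.sqrt_mul' _ (sq_nonneg _), Real.sqrt_sq (norm_nonneg _)]
      _ ≤ Real.sqrt τ * maxColNorm (D + Δ t - Dstar) := by
          gcongr
          exact norm_col_le_maxColNorm (D + Δ t - Dstar) i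
  · rw [hb.aggLoss_eq hγ hΓ hD hsel hclose]
    exact localLoss_le hn hb (D + Δ t)

end Step

/-! ### Constrained concept refinement on random samples -/

theorem theorem4 :
    ∃ c : ℝ, 0 < c ∧ ∃ δ : ℕ → ℝ,
      Asymptotics.SuperpolynomialDecay atTop (fun n : ℕ => (n : ℝ)) δ ∧
      ∀ κ σ₀ : ℝ, 0 < κ → 0 < σ₀ → ∃ C : ℝ, 0 < C ∧
        ∀ (d n k m : ℕ), 1 ≤ k → k ≤ n →
        ∀ (γ Γ σ : ℝ) (ν : Measure ℝ), IsEntryLaw ν γ Γ σ → σ ≤ σ₀ → Γ ≤ κ * σ →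
          C * ((n : ℝ) ^ 6 / (σ ^ 2 * (k : ℝ) ^ 5)) ≤ (m : ℝ) →
        ∀ (Dstar : QueryMatrix d n), ColumnOrthogonal Dstar → FullRank Dstar →
        ∀ (Ω : Type*) [MeasurableSpace Ω] (μ : Measure Ω) [IsProbabilityMeasure μ]
          (β : Fin m → Ω → Fin n → ℝ),
          iIndepFun β μ → (∀ h, HasLaw (β h) (codeLaw n k ν) μ) →
        ∀ (D : QueryMatrix d n) (ρ η : ℝ),
          maxColNorm (D - Dstar) = ρ → ρ ≤ γ / (8 * Real.sqrt k * Γ) →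
          0 < η → η ≤ c / σ ^ 2 →
        ∀ (sel : QueryMatrix d n → EuclideanSpace ℝ (Fin d) → Finset (Fin n)),
          IsSelectionRule k sel →
          μ {ω | ¬ ∀ Δ : ℕ → QueryMatrix d n,
              IsCCRRun (aggLoss Dstar sel (fun h => Dstar.mulVec (β h ω))) D ρ η Δ →
              ∀ t,
                DifferentiableAt ℝ
                  (fun F => aggLoss Dstar sel (fun h => Dstar.mulVec (β h ω)) (D + F)) (Δ t) ∧
                maxColNorm (D + Δ (t + 1) - Dstar) ≤
                  Real.sqrt (1 - (k : ℝ) * ((k : ℝ) - 1) * σ ^ 2 / (2 * (n : ℝ) ^ 2) * η) *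
                    maxColNorm (D + Δ t - Dstar) ∧
                aggLoss Dstar sel (fun h => Dstar.mulVec (β h ω)) (D + Δ t) ≤
                  (k : ℝ) * (∑ h, ‖Dstar.mulVec (β h ω)‖ ^ 2) / (m : ℝ) *
                    maxColNorm (D + Δ t - Dstar) ^ 2}
            ≤ ENNReal.ofReal (δ n) := by
  refine ⟨1 / 32, by norm_num, fun n => Real.exp (-n), fun a => ?_, fun κ σ₀ hκ hσ₀ =>
    ⟨139264 * κ ^ 4 * σ₀ ^ 2, by positivity, ?_⟩⟩
  · exact (Real.tendsto_pow_mul_exp_neg_atTop_nhds_zero a).comp tendsto_natCast_atTop_atTop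
  intro d n k m hk hkn γ Γ σ ν hν hσσ₀ hΓκ hm Dstar hD hR Ω _ μ _ β hind hlaw D ρ η hρ hρle hη hησ
    sel hsel
  have hσ := hν.sigma_pos
  have hk0 : (0 : ℝ) < k := by exact_mod_cast hk
  have hn : 0 < n := hk.trans hkn
  have hn0 : (0 : ℝ) < n := by exact_mod_cast hn
  have hm' : 139264 * κ ^ 4 * ((n : ℝ) ^ 6 / k ^ 5) ≤ m := by
    refine le_trans ?_ hm
    have h1 : 1 ≤ σ₀ ^ 2 / σ ^ 2 := by
      rw [one_le_div (by positivity)]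
      gcongr
    calc 139264 * κ ^ 4 * ((n : ℝ) ^ 6 / k ^ 5)
        ≤ 139264 * κ ^ 4 * ((n : ℝ) ^ 6 / k ^ 5) * (σ₀ ^ 2 / σ ^ 2) :=
          le_mul_of_one_le_right (by positivity) h1
      _ = _ := by field_simp
  have hm0 : 0 < m := by
    have : (0 : ℝ) < m := lt_of_lt_of_le (by positivity) hm'
    exact_mod_cast this
  refine (measure_mono fun ω hω => ?_).trans
    (measure_not_isWellConditioned_le (γ := γ) hν hk hkn hκ hΓκ hind hlaw hm')
  intro hb
  exact hω fun Δ hΔ t => hb.ccr hν.gamma_pos hν.Gamma_pos hσ hk hn hm0 hD hR hρ hρle hη hησ hsel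
    hΔ t
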